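/- Consider the two-user broadcast erasure channel with random receiver side information. For block length $n$, the transmitter has two independent uniformly distributed messages $W_1\in\mathbb{F}_2^{m_1}$ and $W_2\in\mathbb{F}_2^{m_2}$, and sends $X[1],\dots,X[n]\in\mathbb{F}_2$. Receiver $i\in\{1,2\}$ sees $X[t]$ if $S_i[t]=1$ and an erasure if $S_i[t]=0$, where the $S_i[t]$ are i.i.d. over time with $\Pr(S_i[t]=0)=\delta_i$. With $\bar i=3-i$, receiver $i$ has also cached, for each $\ell$, the bit $W_{\bar i}[\ell]$ if $E_i[\ell]=1$ and nothing if $E_i[\ell]=0$, where the $E_i[\ell]$ are i.i.d. with $\Pr(E_i[\ell]=0)=\epsilon_i$. The messages and the processes $S_1,S_2,E_1,E_2$ are independent. Receiver $i$ knows $S_i$ and $E_i$ and estimates $W_i$. The transmitter has no channel state information: a blind encoder is a function of $(W_1,W_2)$ only, a non-blind encoder is a function of $(W_1,W_2,E_1,E_2)$. The code may depend on $\delta_1,\delta_2,\epsilon_1,\epsilon_2$. A pair $(R_1,R_2)$ of non-negative rates is achievable if there are codes of every block length $n$ with $m_i=\lceil nR_i\rceil$ whose error probabilities at both receivers, averaged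 over all the randomness above, tend to $0$ as $n\to\infty$. The capacity regions $\mathcal{C}^{\mathrm{blind}}_{\mathrm{NN}}$ and $\mathcal{C}^{\mathrm{non\text{-}blind}}_{\mathrm{NN}}$ are the closures of the sets of rate pairs achievable with blind and with non-blind encoders. Let $0\le\delta_1,\delta_2<1$ and $0\le\epsilon_1,\epsilon_2\le1$. If 1. $\delta_2\ge\delta_1$ and $\epsilon_2\in\{0,1\}$, or 2. (symmetric setting) $\delta_1=\delta_2=\delta$ and $\epsilon_1=\epsilon_2=\epsilon$, then $\mathcal{C}^{\mathrm{blind}}_{\mathrm{NN}}=\mathcal{C}^{\mathrm{non\text{-}blind}}_{\mathrm{NN}}$, and both equal $$\Big\{(R_1,R_2):\ R_1,R_2\ge0,\quad \beta_1R_1+R_2\le1-\delta_2,\quad R_1+\beta_2R_2\le1-\delta_1\Big\},\qquad \beta_i=\epsilon_{\bar i}\min\Big\{\frac{1-\delta_{\bar i}}{1-\delta_i},1\Big\}.$$ Moreover, in the symmetric setting the corner point $R_1=R_2=\frac{1-\delta}{1+\epsilon}$ is achieved with a blind transmitter by random linear combinations: there are integers $m_n,k_n\ge 0$ with $m_n/n\to\frac{1-\delta}{1+\epsilon}$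 and $k_n/m_n\to1+\epsilon$, and maps $g_n:\mathbb{F}_2^{k_n}\to\mathbb{F}_2^n$, such that if each message has $m_n$ bits, $A_n\in\mathbb{F}_2^{k_n\times 2m_n}$ is uniformly random and known to the transmitter and both receivers, and the transmitter sends $X=g_n\big(A_n(W_1,W_2)\big)$, then for suitable decoders the error probabilities at both receivers, averaged also over $A_n$, tend to $0$. -/

import Mathlib

open Filter Topology

namespace ErasureBC

/-- Words of `m` bits, over the binary field. -/
abbrev Bits (m : ℕ) := Fin m → ZMod 2

/-- The word `x` seen through the on/off pattern `s`: the bit at `t` is delivered if `s t` is on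
and is an erasure (`none`) otherwise. The result carries exactly the information of the pair
`(s, s · x)`. -/
def erase {m : ℕ} (s : Fin m → Bool) (x : Bits m) : Fin m → Option (ZMod 2) :=
  fun t => if s t then some (x t) else none

/-- Probability of the pattern `s` when its entries are i.i.d., each off with probability `p` and on
with probability `1 - p`. -/
def patternProb {m : ℕ} (p : ℝ) (s : Fin m → Bool) : ℝ :=
  ∏ t, if s t then 1 - p else p

/-- A code with a non-blind transmitter and no channel state information at the transmitter: block
length `n`, `m₁` bits for receiver 1, `m₂` bits for receiver 2. The encoder sees both messages and
both cache index patterns (`e₁` says which bits of message 2 are cached at receiver 1, `e₂` which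
bits of message 1 are cached at receiver 2). Receiver `i` sees its channel output with its own
erasure pattern, and its cached part of the other message with its own cache pattern. -/
structure NonBlindCode (n m₁ m₂ : ℕ) where
  /-- the encoder; the `t`-th entry of the value is the channel input `X[t]` -/
  enc : (w₁ : Bits m₁) → (w₂ : Bits m₂) → (e₁ : Fin m₂ → Bool) → (e₂ : Fin m₁ → Bool) → Bits n
  /-- the decoder of receiver 1 -/
  dec₁ : (y₁ : Fin n → Option (ZMod 2)) → (side₁ : Fin m₂ → Option (ZMod 2)) → Bits m₁
  /-- the decoder of receiver 2 -/
  dec₂ : (y₂ : Fin n → Option (ZMod 2)) → (side₂ : Fin m₁ → Option (ZMod 2)) → Bits m₂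

/-- A code with a blind transmitter and no channel state information at the transmitter: the encoder
sees the two messages only. -/
structure BlindCode (n m₁ m₂ : ℕ) where
  /-- the encoder; the `t`-th entry of the value is the channel input `X[t]` -/
  enc : (w₁ : Bits m₁) → (w₂ : Bits m₂) → Bits n
  /-- the decoder of receiver 1 -/
  dec₁ : (y₁ : Fin n → Option (ZMod 2)) → (side₁ : Fin m₂ → Option (ZMod 2)) → Bits m₁
  /-- the decoder of receiver 2 -/
  dec₂ : (y₂ : Fin n → Option (ZMod 2)) → (side₂ : Fin m₁ → Option (ZMod 2)) → Bits m₂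

/-- A blind code is a non-blind code whose encoder ignores the cache index patterns. -/
def BlindCode.toNonBlind {n m₁ m₂ : ℕ} (c : BlindCode n m₁ m₂) : NonBlindCode n m₁ m₂ where
  enc w₁ w₂ _ _ := c.enc w₁ w₂
  dec₁ := c.dec₁
  dec₂ := c.dec₂

/-- Expectation of `f w₁ w₂ s₁ s₂ e₁ e₂`, where all six variables are independent, the messages
`w₁`, `w₂` are uniform, the channel state `sᵢ` is i.i.d. and off with probability `δᵢ`, and the cache
pattern `eᵢ` is i.i.d. and off with probability `εᵢ`. -/
noncomputable def expectation {n m₁ m₂ : ℕ} (δ₁ δ₂ ε₁ ε₂ : ℝ)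
    (f : Bits m₁ → Bits m₂ → (Fin n → Bool) → (Fin n → Bool) →
      (Fin m₂ → Bool) → (Fin m₁ → Bool) → ℝ) : ℝ :=
  ∑ w₁ : Bits m₁, ∑ w₂ : Bits m₂, ∑ s₁ : Fin n → Bool, ∑ s₂ : Fin n → Bool,
    ∑ e₁ : Fin m₂ → Bool, ∑ e₂ : Fin m₁ → Bool,
      (1 / 2 : ℝ) ^ m₁ * (1 / 2 : ℝ) ^ m₂ * patternProb δ₁ s₁ * patternProb δ₂ s₂ *
        patternProb ε₁ e₁ * patternProb ε₂ e₂ * f w₁ w₂ s₁ s₂ e₁ e₂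

/-- Average probability that receiver 1 does not recover its message. -/
noncomputable def NonBlindCode.err₁ {n m₁ m₂ : ℕ} (c : NonBlindCode n m₁ m₂)
    (δ₁ δ₂ ε₁ ε₂ : ℝ) : ℝ :=
  expectation δ₁ δ₂ ε₁ ε₂ fun w₁ w₂ s₁ (_ : Fin n → Bool) e₁ e₂ =>
    if c.dec₁ (erase s₁ (c.enc w₁ w₂ e₁ e₂)) (erase e₁ w₂) = w₁ then 0 else 1

/-- Average probability that receiver 2 does not recover its message. -/
noncomputable def NonBlindCode.err₂ {n m₁ m₂ : ℕ} (c : NonBlindCode n m₁ m₂)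
    (δ₁ δ₂ ε₁ ε₂ : ℝ) : ℝ :=
  expectation δ₁ δ₂ ε₁ ε₂ fun w₁ w₂ (_ : Fin n → Bool) s₂ e₁ e₂ =>
    if c.dec₂ (erase s₂ (c.enc w₁ w₂ e₁ e₂)) (erase e₂ w₁) = w₂ then 0 else 1

/-- The rate pair `R` is achievable with a non-blind transmitter: there are codes of every block
length `n` with `⌈n Rᵢ⌉` bits for receiver `i` such that both error probabilities tend to `0`. -/
def NonBlindAchievable (δ₁ δ₂ ε₁ ε₂ : ℝ) (R : ℝ × ℝ) : Prop :=
  0 ≤ R.1 ∧ 0 ≤ R.2 ∧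
    ∃ c : (n : ℕ) → NonBlindCode n ⌈(n : ℝ) * R.1⌉₊ ⌈(n : ℝ) * R.2⌉₊,
      Tendsto (fun n => (c n).err₁ δ₁ δ₂ ε₁ ε₂) atTop (𝓝 0) ∧
      Tendsto (fun n => (c n).err₂ δ₁ δ₂ ε₁ ε₂) atTop (𝓝 0)

/-- The rate pair `R` is achievable with a blind transmitter. -/
def BlindAchievable (δ₁ δ₂ ε₁ ε₂ : ℝ) (R : ℝ × ℝ) : Prop :=
  0 ≤ R.1 ∧ 0 ≤ R.2 ∧
    ∃ c : (n : ℕ) → BlindCode n ⌈(n : ℝ) * R.1⌉₊ ⌈(n : ℝ) * R.2⌉₊,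
      Tendsto (fun n => (c n).toNonBlind.err₁ δ₁ δ₂ ε₁ ε₂) atTop (𝓝 0) ∧
      Tendsto (fun n => (c n).toNonBlind.err₂ δ₁ δ₂ ε₁ ε₂) atTop (𝓝 0)

/-- Capacity region with a non-blind transmitter and no channel state information at the
transmitter: the closure of the set of achievable rate pairs. -/
def nonBlindCapacity (δ₁ δ₂ ε₁ ε₂ : ℝ) : Set (ℝ × ℝ) :=
  closure {R | NonBlindAchievable δ₁ δ₂ ε₁ ε₂ R}

/-- Capacity region with a blind transmitter and no channel state information at the
transmitter: the closure of the set of achievable rate pairs. -/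
def blindCapacity (δ₁ δ₂ ε₁ ε₂ : ℝ) : Set (ℝ × ℝ) :=
  closure {R | BlindAchievable δ₁ δ₂ ε₁ ε₂ R}

/-- The region of all pairs of non-negative rates with `β₁ R₁ + R₂ ≤ 1 - δ₂` and
`R₁ + β₂ R₂ ≤ 1 - δ₁`, where `β₁ = ε₂ min {(1 - δ₂) / (1 - δ₁), 1}` and
`β₂ = ε₁ min {(1 - δ₁) / (1 - δ₂), 1}`. It is used for `δ₁, δ₂ < 1` only. -/
def rateRegion (δ₁ δ₂ ε₁ ε₂ : ℝ) : Set (ℝ × ℝ) :=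
  {R | 0 ≤ R.1 ∧ 0 ≤ R.2 ∧
    ε₂ * min ((1 - δ₂) / (1 - δ₁)) 1 * R.1 + R.2 ≤ 1 - δ₂ ∧
    R.1 + ε₁ * min ((1 - δ₁) / (1 - δ₂)) 1 * R.2 ≤ 1 - δ₁}

/-- In the symmetric setting with a blind transmitter, the corner point
`R₁ = R₂ = (1 - δ) / (1 + ε)` is achieved by sending random linear combinations: there are numbers
`m n` of bits per receiver with `m n / n → (1 - δ) / (1 + ε)` and numbers `k n` of combinations with
`k n / m n → 1 + ε` such that, when the transmitter forms `k n` uniformly random linear combinations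
of all `2 m n` message bits (the matrix `A`, known to both receivers) and sends them
through a fixed code `g n` from `k n` bits to `n` channel inputs, both error probabilities, averaged
over `A`, tend to `0`. -/
def CornerByRandomCombinations (δ ε : ℝ) : Prop :=
  ∃ (m k : ℕ → ℕ) (g : (n : ℕ) → Bits (k n) → Bits n)
    (c : (n : ℕ) → Matrix (Fin (k n)) (Fin (m n) ⊕ Fin (m n)) (ZMod 2) →
      BlindCode n (m n) (m n)),
    Tendsto (fun n => (m n : ℝ) / n) atTop (𝓝 ((1 - δ) / (1 + ε))) ∧
    Tendsto (fun n => (k n : ℝ) / m n) atTop (𝓝 (1 + ε)) ∧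
    (∀ n A w₁ w₂, (c n A).enc w₁ w₂ = g n (A.mulVec (Sum.elim w₁ w₂))) ∧
    Tendsto (fun n => (∑ A, (c n A).toNonBlind.err₁ δ δ ε ε) /
      Fintype.card (Matrix (Fin (k n)) (Fin (m n) ⊕ Fin (m n)) (ZMod 2))) atTop (𝓝 0) ∧
    Tendsto (fun n => (∑ A, (c n A).toNonBlind.err₂ δ δ ε ε) /
      Fintype.card (Matrix (Fin (k n)) (Fin (m n) ⊕ Fin (m n)) (ZMod 2))) atTop (𝓝 0)

end ErasureBC

/-! A blind code is a non-blind one, so it suffices that non-blind rates obey the two constraints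
and that the region lies in the closure of the blind rates.

Outer bound. Each error probability depends on one channel state only, so the states may be
recoupled: as δ₁ ≤ δ₂, receiver 2's state is taken to be a thinning of receiver 1's. With the cache
patterns given, receiver 1, having decoded its message, can then imitate receiver 2 and decode both.
Its observation has at most 2^(received + cached) values, and counting gives R₁ + ε₁R₂ ≤ 1 - δ₁
(`NonBlindCode.sum_rate_bound`); with equal channels the roles can be exchanged. For ε₂ = 0 the
other constraint is the point-to-point bound R₂ ≤ 1 - δ₂. For ε₂ = 1 it is the degraded broadcast
bound: given W₂, receiver 1's output has entropy about m₁ bits or more, thinning costs at most the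
factor (1 - δ₂)/(1 - δ₁) (`mul_outputEntropy_le_patternMean`), and receiver 2's output, which
determines W₂, retains at most about n(1 - δ₂) - m₂ bits given W₂.

Inner bound. A random binary matrix sends a nonzero vector to a uniform one. By a union bound,
random linear codes work once the wanted bits plus the uncached bits of the other message fall short
of the received symbols (`blindAchievable_of_lt`). Up to closure this fills the region when ε₂ = 0
or in the symmetric setting; for ε₂ = 1 the region is the time-sharing triangle. A Chernoff bound
with tilt n^(-1/3) needs a margin of order n^(2/3) only, so the symmetric corner is approached with
an o(n) loss. -/

namespace ErasureBC

/-! ### Means over i.i.d. on/off patterns. -/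

/-- Mean of `F` over i.i.d. patterns whose entries are off with probability `p`. -/
noncomputable def patternMean {m : ℕ} (p : ℝ) (F : (Fin m → Bool) → ℝ) : ℝ :=
  ∑ s, patternProb p s * F s

/-- Number of entries of a pattern that are on. -/
def onCount {m : ℕ} (s : Fin m → Bool) : ℕ := (Finset.univ.filter fun t => s t = true).card

/-- Number of entries of a pattern that are off. -/
def offCount {m : ℕ} (s : Fin m → Bool) : ℕ := (Finset.univ.filter fun t => s t = false).card

theorem patternProb_nonneg {m : ℕ} {p : ℝ} (h0 : 0 ≤ p) (h1 : p ≤ 1) (s : Fin m → Bool) :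
    0 ≤ patternProb p s :=
  Finset.prod_nonneg fun t _ => by split_ifs <;> linarith

/-- Independence of the entries. The mean count, the thinning identity and both Chernoff bounds are
obtained by writing the integrand as a product over positions. -/
theorem patternMean_prod {m : ℕ} (p : ℝ) (f : Fin m → Bool → ℝ) :
    patternMean p (fun s => ∏ t, f t (s t)) = ∏ t, ((1 - p) * f t true + p * f t false) := by
  have h : ∀ t : Fin m, (1 - p) * f t true + p * f t false
      = ∑ b ∈ (Finset.univ : Finset Bool), (if b then 1 - p else p) * f t b := by
    intro t; simp
  simp_rw [h]
  rw [Finset.prod_univ_sum]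
  simp only [patternMean, patternProb, ← Finset.prod_mul_distrib, Fintype.piFinset_univ]

theorem patternMean_const {m : ℕ} (p c : ℝ) :
    patternMean (m := m) p (fun _ => c) = c := by
  have h := patternMean_prod (m := m) p (fun _ _ => 1)
  simp only [Finset.prod_const_one, mul_one, sub_add_cancel] at h
  simp only [patternMean, mul_one] at h ⊢
  rw [← Finset.sum_mul, h, one_mul]

theorem patternMean_mono {m : ℕ} {p : ℝ} (h0 : 0 ≤ p) (h1 : p ≤ 1) {F G : (Fin m → Bool) → ℝ}
    (h : ∀ s, F s ≤ G s) : patternMean p F ≤ patternMean p G :=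
  Finset.sum_le_sum fun s _ => mul_le_mul_of_nonneg_left (h s) (patternProb_nonneg h0 h1 s)

theorem patternMean_add {m : ℕ} (p : ℝ) (F G : (Fin m → Bool) → ℝ) :
    patternMean p (fun s => F s + G s) = patternMean p F + patternMean p G := by
  simp [patternMean, mul_add, Finset.sum_add_distrib]

theorem patternMean_sub {m : ℕ} (p : ℝ) (F G : (Fin m → Bool) → ℝ) :
    patternMean p (fun s => F s - G s) = patternMean p F - patternMean p G := by
  simp [patternMean, mul_sub, Finset.sum_sub_distrib]

theorem patternMean_const_mul {m : ℕ} (p c : ℝ) (F : (Fin m → Bool) → ℝ) :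
    patternMean p (fun s => c * F s) = c * patternMean p F := by
  simp only [patternMean, Finset.mul_sum]
  exact Finset.sum_congr rfl fun s _ => by ring

theorem patternMean_mul_const {m : ℕ} (p c : ℝ) (F : (Fin m → Bool) → ℝ) :
    patternMean p (fun s => F s * c) = patternMean p F * c := by
  simp only [patternMean, Finset.sum_mul]
  exact Finset.sum_congr rfl fun s _ => by ring

theorem patternMean_sum {m : ℕ} {ι : Type*} (T : Finset ι) (p : ℝ)
    (F : ι → (Fin m → Bool) → ℝ) :
    patternMean p (fun s => ∑ i ∈ T, F i s) = ∑ i ∈ T, patternMean p (F i) := by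
  simp only [patternMean, Finset.mul_sum]
  exact Finset.sum_comm

theorem patternMean_nonneg {m : ℕ} {p : ℝ} (h0 : 0 ≤ p) (h1 : p ≤ 1) {F : (Fin m → Bool) → ℝ}
    (h : ∀ s, 0 ≤ F s) : 0 ≤ patternMean p F :=
  Finset.sum_nonneg fun s _ => mul_nonneg (patternProb_nonneg h0 h1 s) (h s)

theorem patternMean_comm {m n : ℕ} (p q : ℝ) (F : (Fin m → Bool) → (Fin n → Bool) → ℝ) :
    patternMean p (fun s => patternMean q (fun r => F s r))
      = patternMean q (fun r => patternMean p (fun s => F s r)) := by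
  simp only [patternMean, Finset.mul_sum]
  rw [Finset.sum_comm]
  exact Finset.sum_congr rfl fun r _ => Finset.sum_congr rfl fun s _ => by ring

theorem patternMean_onCount {m : ℕ} (p : ℝ) :
    patternMean (m := m) p (fun s => (onCount s : ℝ)) = m * (1 - p) := by
  have h : ∀ s : Fin m → Bool, (onCount s : ℝ) = ∑ t, if s t then (1 : ℝ) else 0 := by
    intro s; simp [onCount]
  simp_rw [h]
  rw [patternMean_sum]
  have h2 : ∀ t : Fin m, patternMean p (fun s => if s t then (1 : ℝ) else 0) = 1 - p := by
    intro t
    have := patternMean_prod (m := m) p (fun t' b => if t' = t then (if b then 1 else 0) else 1)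
    rw [Finset.prod_eq_single t] at this
    · simp only [if_true] at this
      rw [show (fun s : Fin m → Bool => if s t then (1 : ℝ) else 0)
        = fun s => ∏ t', if t' = t then (if s t' then 1 else 0) else 1 by
          funext s; simp, this]
      simp
    · intro b _ hb; simp [hb]
    · simp
  simp_rw [h2]
  rw [Finset.sum_const, Finset.card_univ, Fintype.card_fin, nsmul_eq_mul]

/-- Thinning: an i.i.d. pattern that is on with probability `(1 - p) (1 - q)` is the conjunction of
independent patterns that are on with probabilities `1 - p` and `1 - q`. -/
theorem patternMean_and {m : ℕ} (p q r : ℝ) (h : 1 - r = (1 - p) * (1 - q))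
    (F : (Fin m → Bool) → ℝ) :
    patternMean p (fun s => patternMean q (fun u => F (fun t => s t && u t)))
      = patternMean r F := by
  -- The law of the conjunction is found at one pattern `v` at a time, where the indicator is a
  -- product over entries; `hF` then expands `F` in these indicators.
  have key : ∀ v : Fin m → Bool,
      patternMean p (fun s => patternMean q (fun u => ∏ t, if (s t && u t) = v t then (1 : ℝ) else 0))
        = patternProb r v := by
    intro v
    have h1 : ∀ s : Fin m → Bool,
        patternMean q (fun u => ∏ t, if (s t && u t) = v t then (1 : ℝ) else 0)
        = ∏ t, ((1 - q) * (if (s t && true) = v t then (1 : ℝ) else 0)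
            + q * (if (s t && false) = v t then (1 : ℝ) else 0)) := fun s =>
      patternMean_prod q (fun t b => if (s t && b) = v t then (1 : ℝ) else 0)
    simp_rw [h1]
    rw [patternMean_prod p (fun t b => ((1 - q) * (if (b && true) = v t then (1 : ℝ) else 0)
            + q * (if (b && false) = v t then (1 : ℝ) else 0)))]
    refine Finset.prod_congr rfl fun t _ => ?_
    cases v t <;> simp <;> linarith
  have hF : ∀ v : Fin m → Bool, F v = ∑ w, (∏ t, if v t = w t then (1 : ℝ) else 0) * F w := by
    intro v
    have : ∀ w : Fin m → Bool, (∏ t, if v t = w t then (1 : ℝ) else 0) = if v = w then 1 else 0 := by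
      intro w
      rw [Finset.prod_ite_zero]
      simp [funext_iff]
    simp [this]
  calc _ = patternMean p (fun s => patternMean q (fun u =>
        ∑ w, (∏ t, if (s t && u t) = w t then (1 : ℝ) else 0) * F w)) := by
        simp_rw [← hF]
    _ = ∑ w, patternProb r w * F w := by
        simp_rw [patternMean_sum, patternMean_mul_const, key]
    _ = _ := rfl

theorem patternMean_of_eq_one {m : ℕ} (F : (Fin m → Bool) → ℝ) :
    patternMean 1 F = F (fun _ => false) := by
  have : ∀ s : Fin m → Bool, patternProb 1 s = if s = (fun _ => false) then 1 else 0 := by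
    intro s
    have : patternProb 1 s = ∏ t, if s t = false then (1 : ℝ) else 0 :=
      Finset.prod_congr rfl fun t _ => by cases s t <;> simp
    rw [this, Finset.prod_ite_zero]
    simp [funext_iff]
  simp [patternMean, this]

/-! ### Message averages and error probabilities. -/

theorem sum_comm_four {ι α β γ κ : Type*} [Fintype ι] [Fintype α] [Fintype β] [Fintype γ]
    [Fintype κ] (g : ι → α → β → γ → κ → ℝ) :
    ∑ i, ∑ a, ∑ b, ∑ c, ∑ d, g i a b c d = ∑ a, ∑ b, ∑ c, ∑ d, ∑ i, g i a b c d := by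
  rw [Finset.sum_comm]
  refine Finset.sum_congr rfl fun a _ => ?_
  rw [Finset.sum_comm]
  refine Finset.sum_congr rfl fun b _ => ?_
  rw [Finset.sum_comm]
  refine Finset.sum_congr rfl fun c _ => ?_
  rw [Finset.sum_comm]

/-- Mean over a pair of independent uniform messages. -/
noncomputable def messageMean {m₁ m₂ : ℕ} (f : Bits m₁ → Bits m₂ → ℝ) : ℝ :=
  (1 / 2 : ℝ) ^ m₁ * (1 / 2 : ℝ) ^ m₂ * ∑ w₁, ∑ w₂, f w₁ w₂

/-- With the messages innermost, each bound can be proved for fixed patterns, by counting or entropy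
over the messages, and then averaged. -/
theorem expectation_eq {n m₁ m₂ : ℕ} (δ₁ δ₂ ε₁ ε₂ : ℝ)
    (f : Bits m₁ → Bits m₂ → (Fin n → Bool) → (Fin n → Bool) →
      (Fin m₂ → Bool) → (Fin m₁ → Bool) → ℝ) :
    expectation δ₁ δ₂ ε₁ ε₂ f
      = patternMean δ₁ fun s₁ => patternMean δ₂ fun s₂ => patternMean ε₁ fun e₁ =>
          patternMean ε₂ fun e₂ => messageMean fun w₁ w₂ => f w₁ w₂ s₁ s₂ e₁ e₂ := by
  unfold expectation
  rw [Finset.sum_congr rfl fun w₁ _ => sum_comm_four _, sum_comm_four]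
  simp only [patternMean, messageMean, Finset.mul_sum]
  refine Finset.sum_congr rfl fun s₁ _ => Finset.sum_congr rfl fun s₂ _ =>
    Finset.sum_congr rfl fun e₁ _ => Finset.sum_congr rfl fun e₂ _ =>
    Finset.sum_congr rfl fun w₁ _ => Finset.sum_congr rfl fun w₂ _ => ?_
  ring

theorem messageMean_mono {m₁ m₂ : ℕ} {f g : Bits m₁ → Bits m₂ → ℝ}
    (h : ∀ w₁ w₂, f w₁ w₂ ≤ g w₁ w₂) : messageMean f ≤ messageMean g :=
  mul_le_mul_of_nonneg_left (Finset.sum_le_sum fun w₁ _ => Finset.sum_le_sum fun w₂ _ => h w₁ w₂)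
    (by positivity)

theorem messageMean_const {m₁ m₂ : ℕ} (c : ℝ) :
    messageMean (fun (_ : Bits m₁) (_ : Bits m₂) => c) = c := by
  simp only [messageMean, Finset.sum_const, Finset.card_univ, Fintype.card_fun, ZMod.card,
    Fintype.card_fin, nsmul_eq_mul]
  push_cast
  rw [show (1 / 2 : ℝ) ^ m₁ * (1 / 2) ^ m₂ * (2 ^ m₁ * (2 ^ m₂ * c))
    = ((1 / 2 : ℝ) ^ m₁ * 2 ^ m₁) * ((1 / 2) ^ m₂ * 2 ^ m₂) * c by ring]
  simp

theorem messageMean_swap {m₁ m₂ : ℕ} (f : Bits m₁ → Bits m₂ → ℝ) :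
    messageMean (fun w₂ w₁ => f w₁ w₂) = messageMean f := by
  simp only [messageMean]
  rw [Finset.sum_comm, mul_comm ((1 / 2 : ℝ) ^ m₂)]

/-- The other receiver's channel state averages out. Hence the converse may replace the independent
pair of states by any coupling with the same marginals. -/
theorem NonBlindCode.err₁_eq {n m₁ m₂ : ℕ} (c : NonBlindCode n m₁ m₂) (δ₁ δ₂ ε₁ ε₂ : ℝ) :
    c.err₁ δ₁ δ₂ ε₁ ε₂ = patternMean δ₁ fun s₁ => patternMean ε₁ fun e₁ => patternMean ε₂ fun e₂ =>
      messageMean fun w₁ w₂ =>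
        if c.dec₁ (erase s₁ (c.enc w₁ w₂ e₁ e₂)) (erase e₁ w₂) = w₁ then 0 else 1 := by
  rw [NonBlindCode.err₁, expectation_eq]
  simp_rw [patternMean_const]

theorem NonBlindCode.err₂_eq {n m₁ m₂ : ℕ} (c : NonBlindCode n m₁ m₂) (δ₁ δ₂ ε₁ ε₂ : ℝ) :
    c.err₂ δ₁ δ₂ ε₁ ε₂ = patternMean δ₂ fun s₂ => patternMean ε₁ fun e₁ => patternMean ε₂ fun e₂ =>
      messageMean fun w₁ w₂ =>
        if c.dec₂ (erase s₂ (c.enc w₁ w₂ e₁ e₂)) (erase e₂ w₁) = w₂ then 0 else 1 := by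
  rw [NonBlindCode.err₂, expectation_eq]
  simp_rw [patternMean_const]

/-- The code with the roles of the two receivers exchanged. -/
def NonBlindCode.swap {n m₁ m₂ : ℕ} (c : NonBlindCode n m₁ m₂) : NonBlindCode n m₂ m₁ where
  enc w₂ w₁ e₂ e₁ := c.enc w₁ w₂ e₁ e₂
  dec₁ := c.dec₂
  dec₂ := c.dec₁

theorem NonBlindCode.err₁_swap {n m₁ m₂ : ℕ} (c : NonBlindCode n m₁ m₂) (δ₁ δ₂ ε₁ ε₂ : ℝ) :
    c.swap.err₁ δ₂ δ₁ ε₂ ε₁ = c.err₂ δ₁ δ₂ ε₁ ε₂ := by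
  rw [NonBlindCode.err₁_eq, NonBlindCode.err₂_eq]
  congr 1; funext s₂
  rw [patternMean_comm]
  congr 1; funext e₁; congr 1; funext e₂
  exact messageMean_swap _

theorem NonBlindCode.err₂_swap {n m₁ m₂ : ℕ} (c : NonBlindCode n m₁ m₂) (δ₁ δ₂ ε₁ ε₂ : ℝ) :
    c.swap.err₂ δ₂ δ₁ ε₂ ε₁ = c.err₁ δ₁ δ₂ ε₁ ε₂ :=
  (c.swap.err₁_swap δ₂ δ₁ ε₂ ε₁).symm

theorem NonBlindCode.err₁_nonneg {n m₁ m₂ : ℕ} (c : NonBlindCode n m₁ m₂) {δ₁ δ₂ ε₁ ε₂ : ℝ}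
    (hδ₁ : 0 ≤ δ₁ ∧ δ₁ ≤ 1) (hε₁ : 0 ≤ ε₁ ∧ ε₁ ≤ 1) (hε₂ : 0 ≤ ε₂ ∧ ε₂ ≤ 1) :
    0 ≤ c.err₁ δ₁ δ₂ ε₁ ε₂ := by
  rw [NonBlindCode.err₁_eq]
  refine patternMean_nonneg hδ₁.1 hδ₁.2 fun s => patternMean_nonneg hε₁.1 hε₁.2 fun e₁ =>
    patternMean_nonneg hε₂.1 hε₂.2 fun e₂ => ?_
  unfold messageMean
  refine mul_nonneg (by positivity) (Finset.sum_nonneg fun w₁ _ => Finset.sum_nonneg fun w₂ _ => ?_)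
  dsimp only
  split_ifs <;> norm_num

theorem NonBlindCode.err₂_nonneg {n m₁ m₂ : ℕ} (c : NonBlindCode n m₁ m₂) {δ₁ δ₂ ε₁ ε₂ : ℝ}
    (hδ₂ : 0 ≤ δ₂ ∧ δ₂ ≤ 1) (hε₁ : 0 ≤ ε₁ ∧ ε₁ ≤ 1) (hε₂ : 0 ≤ ε₂ ∧ ε₂ ≤ 1) :
    0 ≤ c.err₂ δ₁ δ₂ ε₁ ε₂ := by
  rw [← c.err₁_swap]
  exact c.swap.err₁_nonneg hδ₂ hε₂ hε₁

/-! ### Counting converses for the sum rate and the single rate. -/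

theorem card_image_erase_le {n : ℕ} (s : Fin n → Bool) :
    (Finset.univ.image (erase s)).card ≤ 2 ^ onCount s := by
  let φ : ({t : Fin n // s t = true} → ZMod 2) → Fin n → Option (ZMod 2) :=
    fun z t => if h : s t = true then some (z ⟨t, h⟩) else none
  have h1 : Finset.univ.image (erase s) ⊆ Finset.univ.image φ := by
    intro y hy
    obtain ⟨x, -, rfl⟩ := Finset.mem_image.1 hy
    refine Finset.mem_image.2 ⟨fun t => x t, Finset.mem_univ _, ?_⟩
    funext t
    by_cases h : s t = true <;> simp [φ, erase, h]
  refine (Finset.card_le_card h1).trans (Finset.card_image_le.trans ?_)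
  rw [Finset.card_univ, Fintype.card_fun, ZMod.card, Fintype.card_subtype]
  rfl

theorem erase_eq_erase_iff {n : ℕ} (s : Fin n → Bool) (x y : Bits n) :
    erase s x = erase s y ↔ ∀ t, s t = true → x t = y t := by
  rw [funext_iff]
  refine forall_congr' fun t => ?_
  by_cases h : s t = true <;> simp [erase, h]

theorem neg_mul_log_le_one {g : ℝ} (h0 : 0 ≤ g) : -(g * Real.log g) ≤ 1 := by
  rcases h0.eq_or_lt with rfl | h
  · simp
  have := Real.one_sub_inv_le_log_of_pos h
  have h2 := mul_le_mul_of_nonneg_left this h.le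
  rw [mul_sub, mul_inv_cancel₀ h.ne'] at h2
  linarith

/-- Taking logarithms and multiplying by `g` leaves the excess -g log g, which is at most 1. This
yields a bound linear in `g`, ready for averaging over patterns. -/
theorem mul_log_two_le_of_mul_pow_le {g : ℝ} {m a : ℕ} (h0 : 0 ≤ g) (h1 : g ≤ 1)
    (h : g * 2 ^ m ≤ 2 ^ a) : g * (m * Real.log 2) ≤ a * Real.log 2 + 1 := by
  have hl : 0 < Real.log 2 := Real.log_pos (by norm_num)
  rcases h0.eq_or_lt with rfl | hg
  · simp; positivity
  have h2 := Real.log_le_log (by positivity) h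
  rw [Real.log_mul hg.ne' (by positivity), Real.log_pow, Real.log_pow] at h2
  have h3 := mul_le_mul_of_nonneg_left h2 h0
  have h4 := neg_mul_log_le_one h0
  have h5 : g * (a * Real.log 2) ≤ 1 * (a * Real.log 2) :=
    mul_le_mul_of_nonneg_right h1 (by positivity)
  linarith

/-- If the pairs of messages outside an exceptional set are determined by an observation with at
most `2 ^ a` values, then the fraction of such pairs is small. -/
theorem messageMean_le_of_injOn {m₁ m₂ a : ℕ} {Y : Type*} [DecidableEq Y]
    (P : Bits m₁ → Bits m₂ → Prop) [∀ w₁ w₂, Decidable (P w₁ w₂)]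
    (f : Bits m₁ → Bits m₂ → Y) (T : Finset Y) (hT : T.card ≤ 2 ^ a)
    (hf : ∀ w₁ w₂, f w₁ w₂ ∈ T)
    (hinj : ∀ w₁ w₂ v₁ v₂, P w₁ w₂ → P v₁ v₂ → f w₁ w₂ = f v₁ v₂ → w₁ = v₁ ∧ w₂ = v₂) :
    messageMean (fun w₁ w₂ => if P w₁ w₂ then (1 : ℝ) else 0) * ((m₁ + m₂ : ℝ) * Real.log 2)
      ≤ a * Real.log 2 + 1 := by
  have hmm : messageMean (fun w₁ w₂ => if P w₁ w₂ then (1 : ℝ) else 0) * 2 ^ (m₁ + m₂)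
      = ((Finset.univ.filter fun w : Bits m₁ × Bits m₂ => P w.1 w.2).card : ℝ) := by
    rw [messageMean, Finset.card_filter, Fintype.sum_prod_type]
    push_cast
    rw [pow_add, mul_comm, ← mul_assoc, mul_mul_mul_comm, ← mul_pow, ← mul_pow]
    norm_num
  have := mul_log_two_le_of_mul_pow_le (m := m₁ + m₂) (a := a)
    (g := messageMean (fun w₁ w₂ => if P w₁ w₂ then (1 : ℝ) else 0)) ?_ ?_ ?_
  · simpa using this
  · exact (messageMean_const 0).ge.trans (messageMean_mono fun _ _ => by split_ifs <;> norm_num)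
  · exact (messageMean_mono fun _ _ => by split_ifs <;> norm_num).trans (messageMean_const 1).le
  · rw [hmm]
    have hc : (Finset.univ.filter fun w : Bits m₁ × Bits m₂ => P w.1 w.2).card ≤ T.card := by
      refine Finset.card_le_card_of_injOn (fun w => f w.1 w.2) (fun w _ => hf _ _) ?_
      rintro ⟨w₁, w₂⟩ hw ⟨v₁, v₂⟩ hv h
      simp only [Finset.coe_filter, Finset.mem_univ, true_and, Set.mem_ofPred_eq] at hw hv
      obtain ⟨rfl, rfl⟩ := hinj _ _ _ _ hw hv h
      rfl
    exact_mod_cast hc.trans hT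

theorem messageMean_one_sub_sub {m₁ m₂ : ℕ} (f g : Bits m₁ → Bits m₂ → ℝ) :
    messageMean (fun w₁ w₂ => 1 - f w₁ w₂ - g w₁ w₂) = 1 - messageMean f - messageMean g := by
  conv_rhs => rw [← messageMean_const (m₁ := m₁) (m₂ := m₂) 1]
  simp only [messageMean, Finset.sum_sub_distrib, mul_sub]

/-- When receiver 1 has the better channel it can, after decoding its own message, emulate
receiver 2; so it learns both messages from its channel output and its cache. -/
theorem NonBlindCode.sum_rate_bound {n m₁ m₂ : ℕ} (c : NonBlindCode n m₁ m₂) {δ₁ δ₂ ε₁ ε₂ : ℝ}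
    (hδ₁ : 0 ≤ δ₁ ∧ δ₁ < 1) (hδ₂ : δ₂ < 1) (hδ : δ₁ ≤ δ₂)
    (hε₁ : 0 ≤ ε₁ ∧ ε₁ ≤ 1) (hε₂ : 0 ≤ ε₂ ∧ ε₂ ≤ 1) :
    (1 - c.err₁ δ₁ δ₂ ε₁ ε₂ - c.err₂ δ₁ δ₂ ε₁ ε₂) * ((m₁ + m₂ : ℝ) * Real.log 2)
      ≤ (n * (1 - δ₁) + m₂ * (1 - ε₁)) * Real.log 2 + 1 := by
  have hpos : 0 < 1 - δ₁ := by linarith [hδ₁.2]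
  -- The additional erasure probability that turns receiver 1's channel into one with the statistics
  -- of receiver 2's.
  set q : ℝ := (δ₂ - δ₁) / (1 - δ₁) with hq
  have hq0 : 0 ≤ q := div_nonneg (by linarith) hpos.le
  have hq1 : q ≤ 1 := (div_le_one hpos).2 (by linarith)
  have hq2 : 1 - δ₂ = (1 - δ₁) * (1 - q) := by rw [hq]; field_simp; ring
  set B₁ : (Fin n → Bool) → (Fin m₂ → Bool) → (Fin m₁ → Bool) → ℝ := fun s e₁ e₂ =>
    messageMean fun w₁ w₂ =>
      if c.dec₁ (erase s (c.enc w₁ w₂ e₁ e₂)) (erase e₁ w₂) = w₁ then 0 else 1 with hB₁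
  set B₂ : (Fin n → Bool) → (Fin m₂ → Bool) → (Fin m₁ → Bool) → ℝ := fun s e₁ e₂ =>
    messageMean fun w₁ w₂ =>
      if c.dec₂ (erase s (c.enc w₁ w₂ e₁ e₂)) (erase e₂ w₁) = w₂ then 0 else 1 with hB₂
  -- For fixed patterns, the output through `s` and the cached bits give `w₁`; then the thinner
  -- output and the cached part of `w₁` give `w₂`.
  have key : ∀ (s r : Fin n → Bool) e₁ e₂, (1 - B₁ s e₁ e₂ - B₂ (fun t => s t && r t) e₁ e₂)
      * ((m₁ + m₂ : ℝ) * Real.log 2) ≤ ((onCount s : ℝ) + onCount e₁) * Real.log 2 + 1 := by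
    intro s r e₁ e₂
    set s₂ : Fin n → Bool := fun t => s t && r t with hs₂
    have h := messageMean_le_of_injOn (a := onCount s + onCount e₁)
      (fun w₁ w₂ => c.dec₁ (erase s (c.enc w₁ w₂ e₁ e₂)) (erase e₁ w₂) = w₁ ∧
        c.dec₂ (erase s₂ (c.enc w₁ w₂ e₁ e₂)) (erase e₂ w₁) = w₂)
      (fun w₁ w₂ => (erase s (c.enc w₁ w₂ e₁ e₂), erase e₁ w₂))
      ((Finset.univ.image (erase s)) ×ˢ (Finset.univ.image (erase e₁)))
      (by
        rw [Finset.card_product, pow_add]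
        exact Nat.mul_le_mul (card_image_erase_le s) (card_image_erase_le e₁))
      (fun w₁ w₂ => Finset.mem_product.2 ⟨Finset.mem_image_of_mem _ (Finset.mem_univ _),
        Finset.mem_image_of_mem _ (Finset.mem_univ _)⟩)
      (by
        rintro w₁ w₂ v₁ v₂ ⟨hw1, hw2⟩ ⟨hv1, hv2⟩ hwv
        obtain ⟨hy, hz⟩ := Prod.mk.inj hwv
        have h1 : w₁ = v₁ := by rw [← hw1, ← hv1, hy, hz]
        have hy2 : erase s₂ (c.enc w₁ w₂ e₁ e₂) = erase s₂ (c.enc v₁ v₂ e₁ e₂) := by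
          rw [erase_eq_erase_iff] at hy ⊢
          intro t ht
          exact hy t (by simp only [hs₂, Bool.and_eq_true] at ht; exact ht.1)
        refine ⟨h1, ?_⟩
        rw [← hw2, ← hv2, hy2, h1])
    push_cast at h
    refine le_trans (mul_le_mul_of_nonneg_right ?_ ?_) h
    · rw [hB₁, hB₂]
      dsimp only
      rw [← messageMean_one_sub_sub]
      refine messageMean_mono fun w₁ w₂ => ?_
      split_ifs <;> simp_all
    · have := Real.log_pos (show (1 : ℝ) < 2 by norm_num)
      positivity
  have h := patternMean_mono hδ₁.1 hδ₁.2.le fun s => patternMean_mono hq0 hq1 fun r =>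
    patternMean_mono hε₁.1 hε₁.2 fun e₁ => patternMean_mono hε₂.1 hε₂.2 fun e₂ => key s r e₁ e₂
  simp_rw [patternMean_mul_const, patternMean_sub, patternMean_add, patternMean_mul_const,
    patternMean_add, patternMean_const, patternMean_onCount] at h
  -- Averaged over `s` and `r`, the conjunction has the law of receiver 2's state, so its error term
  -- is the true `err₂`.
  have h2 := patternMean_and δ₁ q δ₂ hq2 fun s₂ => patternMean ε₁ fun e₁ =>
    patternMean ε₂ fun e₂ => B₂ s₂ e₁ e₂
  rw [h2] at h
  rw [c.err₁_eq, c.err₂_eq]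
  linarith

theorem messageMean_one_sub {m₁ m₂ : ℕ} (f : Bits m₁ → Bits m₂ → ℝ) :
    messageMean (fun w₁ w₂ => 1 - f w₁ w₂) = 1 - messageMean f := by
  conv_rhs => rw [← messageMean_const (m₁ := m₁) (m₂ := m₂) 1]
  simp only [messageMean, Finset.sum_sub_distrib, mul_sub]

/-- Receiver 2 is granted all of message 1, which makes its cache irrelevant. The two occurrences of
`m₁` cancel in the limit. -/
theorem NonBlindCode.single_rate_bound {n m₁ m₂ : ℕ} (c : NonBlindCode n m₁ m₂) {δ₁ δ₂ ε₁ ε₂ : ℝ}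
    (hδ₂ : 0 ≤ δ₂ ∧ δ₂ ≤ 1) (hε₁ : 0 ≤ ε₁ ∧ ε₁ ≤ 1) (hε₂ : 0 ≤ ε₂ ∧ ε₂ ≤ 1) :
    (1 - c.err₂ δ₁ δ₂ ε₁ ε₂) * ((m₁ + m₂ : ℝ) * Real.log 2)
      ≤ (m₁ + n * (1 - δ₂)) * Real.log 2 + 1 := by
  have key : ∀ (s : Fin n → Bool) (e₁ : Fin m₂ → Bool) (e₂ : Fin m₁ → Bool),
      (1 - messageMean fun w₁ w₂ =>
        if c.dec₂ (erase s (c.enc w₁ w₂ e₁ e₂)) (erase e₂ w₁) = w₂ then (0 : ℝ) else 1)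
      * ((m₁ + m₂ : ℝ) * Real.log 2) ≤ ((m₁ : ℝ) + onCount s) * Real.log 2 + 1 := by
    intro s e₁ e₂
    have h := messageMean_le_of_injOn (a := m₁ + onCount s)
      (fun w₁ w₂ => c.dec₂ (erase s (c.enc w₁ w₂ e₁ e₂)) (erase e₂ w₁) = w₂)
      (fun w₁ w₂ => (w₁, erase s (c.enc w₁ w₂ e₁ e₂)))
      ((Finset.univ : Finset (Bits m₁)) ×ˢ (Finset.univ.image (erase s)))
      (by
        rw [Finset.card_product, pow_add]
        exact Nat.mul_le_mul (by simp) (card_image_erase_le s))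
      (fun w₁ w₂ => Finset.mem_product.2 ⟨Finset.mem_univ _,
        Finset.mem_image_of_mem _ (Finset.mem_univ _)⟩)
      (by
        rintro w₁ w₂ v₁ v₂ hw2 hv2 hwv
        obtain ⟨hz, hy⟩ := Prod.mk.inj hwv
        refine ⟨hz, ?_⟩
        rw [← hw2, ← hv2, hy, hz])
    push_cast at h
    refine le_trans (mul_le_mul_of_nonneg_right ?_ ?_) h
    · refine (messageMean_one_sub _).ge.trans (messageMean_mono fun w₁ w₂ => ?_)
      split_ifs <;> simp_all
    · have := Real.log_pos (show (1 : ℝ) < 2 by norm_num)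
      positivity
  have h := patternMean_mono hδ₂.1 hδ₂.2 fun s =>
    patternMean_mono hε₁.1 hε₁.2 fun e₁ => patternMean_mono hε₂.1 hε₂.2 fun e₂ => key s e₁ e₂
  simp_rw [patternMean_mul_const, patternMean_sub, patternMean_add, patternMean_mul_const,
    patternMean_add, patternMean_const, patternMean_onCount] at h
  rw [c.err₂_eq]
  linarith

/-! ### The log sum inequality and output entropy under erasures. -/

theorem negMulLog_le {a q : ℝ} (ha : 0 ≤ a) (hq : 0 < q) :
    Real.negMulLog a ≤ -(a * Real.log q) + q - a := by
  rcases ha.eq_or_lt with rfl | ha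
  · simpa using hq.le
  have h := Real.log_le_sub_one_of_pos (div_pos hq ha)
  rw [Real.log_div hq.ne' ha.ne'] at h
  have h2 := mul_le_mul_of_nonneg_left h ha.le
  rw [mul_sub, mul_sub, mul_div_cancel₀ _ ha.ne'] at h2
  rw [Real.negMulLog]
  linarith

/-- Tangent line bound for a log(A/a), tight at a = Aθ. A common θ for two pairs makes the bounds
add; the pooled ratio (a + b)/(A + B) cancels the correction terms. -/
theorem negMulLog_add_mul_log_le {a A θ : ℝ} (ha : 0 ≤ a) (hA : a ≤ A) (hθ : 0 < θ) :
    Real.negMulLog a + a * Real.log A ≤ -(a * Real.log θ) + A * θ - a := by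
  rcases (ha.trans hA).eq_or_lt with rfl | hA0
  · obtain rfl : a = 0 := le_antisymm hA ha
    simp
  have h := negMulLog_le ha (mul_pos hA0 hθ)
  rw [Real.log_mul hA0.ne' hθ.ne'] at h
  linarith

/-- The log sum inequality. -/
theorem log_sum_superadditive {a A b B : ℝ} (ha : 0 ≤ a) (hA : a ≤ A) (hb : 0 ≤ b) (hB : b ≤ B) :
    (Real.negMulLog a + a * Real.log A) + (Real.negMulLog b + b * Real.log B)
      ≤ Real.negMulLog (a + b) + (a + b) * Real.log (A + B) := by
  rcases (add_nonneg ha hb).eq_or_lt with h0 | h0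
  · obtain rfl : a = 0 := by linarith
    obtain rfl : b = 0 := by linarith
    simp
  have hAB : 0 < A + B := by linarith
  have hθ : 0 < (a + b) / (A + B) := div_pos h0 hAB
  have h1 := negMulLog_add_mul_log_le ha hA hθ
  have h2 := negMulLog_add_mul_log_le hb hB hθ
  have h3 : (A + B) * ((a + b) / (A + B)) = a + b := mul_div_cancel₀ _ hAB.ne'
  have h4 := Real.log_div h0.ne' hAB.ne'
  rw [Real.negMulLog.eq_1 (a + b)]
  generalize (a + b) / (A + B) = θ at h1 h2 h3 h4
  rw [h4] at h1 h2
  linarith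

/-- Mass of the channel output `y` when the input has mass function `μ`. -/
noncomputable def outputMass {n : ℕ} (s : Fin n → Bool) (μ : Bits n → ℝ)
    (y : Fin n → Option (ZMod 2)) : ℝ :=
  ∑ x, if erase s x = y then μ x else 0

/-- Entropy, in nats, of the channel output for a not necessarily normalised input mass function,
scaled by the total mass. -/
noncomputable def outputEntropy {n : ℕ} (s : Fin n → Bool) (μ : Bits n → ℝ) : ℝ :=
  ∑ y, Real.negMulLog (outputMass s μ y) - Real.negMulLog (∑ x, μ x)

theorem sum_outputMass {n : ℕ} (s : Fin n → Bool) (μ : Bits n → ℝ) :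
    ∑ y, outputMass s μ y = ∑ x, μ x := by
  simp only [outputMass]
  rw [Finset.sum_comm]
  simp

theorem outputMass_nonneg {n : ℕ} (s : Fin n → Bool) {μ : Bits n → ℝ} (hμ : ∀ x, 0 ≤ μ x)
    (y : Fin n → Option (ZMod 2)) : 0 ≤ outputMass s μ y :=
  Finset.sum_nonneg fun x _ => by split_ifs <;> simp [hμ]

theorem outputMass_add {n : ℕ} (s : Fin n → Bool) (μ ν : Bits n → ℝ)
    (y : Fin n → Option (ZMod 2)) :
    outputMass s (μ + ν) y = outputMass s μ y + outputMass s ν y := by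
  simp only [outputMass, ← Finset.sum_add_distrib]
  exact Finset.sum_congr rfl fun x _ => by split_ifs <;> simp

/-- Each summand has the form a log(A/a) with A the total mass, so that the log sum inequality
applies output value by output value. -/
theorem outputEntropy_eq {n : ℕ} (s : Fin n → Bool) (μ : Bits n → ℝ) :
    outputEntropy s μ
      = ∑ y, (Real.negMulLog (outputMass s μ y) + outputMass s μ y * Real.log (∑ x, μ x)) := by
  rw [Finset.sum_add_distrib, ← Finset.sum_mul, sum_outputMass, outputEntropy,
    Real.negMulLog.eq_1 (∑ x, μ x)]
  ring

/-- Concavity of entropy: with the scaling by total mass it becomes superadditivity. -/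
theorem outputEntropy_superadditive {n : ℕ} (s : Fin n → Bool) {μ ν : Bits n → ℝ}
    (hμ : ∀ x, 0 ≤ μ x) (hν : ∀ x, 0 ≤ ν x) :
    outputEntropy s μ + outputEntropy s ν ≤ outputEntropy s (μ + ν) := by
  simp only [outputEntropy_eq, ← Finset.sum_add_distrib]
  refine Finset.sum_le_sum fun y _ => ?_
  rw [outputMass_add]
  simp only [Pi.add_apply, Finset.sum_add_distrib]
  refine log_sum_superadditive (outputMass_nonneg s hμ y) ?_ (outputMass_nonneg s hν y) ?_
  · rw [← sum_outputMass s μ]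
    exact Finset.single_le_sum (fun z _ => outputMass_nonneg s hμ z) (Finset.mem_univ y)
  · rw [← sum_outputMass s ν]
    exact Finset.single_le_sum (fun z _ => outputMass_nonneg s hν z) (Finset.mem_univ y)

theorem sum_fin_cons {n : ℕ} {α : Type*} [Fintype α] (f : (Fin (n + 1) → α) → ℝ) :
    ∑ x, f x = ∑ b, ∑ x : Fin n → α, f (Fin.cons b x) := by
  rw [← Fintype.sum_prod_type', ← (Fin.consEquiv fun _ : Fin (n + 1) => α).sum_comp]
  rfl

theorem patternMean_succ {n : ℕ} (q : ℝ) (F : (Fin (n + 1) → Bool) → ℝ) :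
    patternMean q F = (1 - q) * patternMean q (fun r : Fin n → Bool => F (Fin.cons true r))
      + q * patternMean q (fun r : Fin n → Bool => F (Fin.cons false r)) := by
  simp only [patternMean]
  rw [sum_fin_cons]
  simp only [Fintype.sum_bool, patternProb, Fin.prod_univ_succ, Fin.cons_zero, Fin.cons_succ,
    Finset.mul_sum]
  simp [mul_assoc]

theorem erase_cons {n : ℕ} (a : Bool) (s : Fin n → Bool) (b : ZMod 2) (x : Bits n) :
    erase (Fin.cons a s : Fin (n + 1) → Bool) (Fin.cons b x : Bits (n + 1))
      = (Fin.cons (if a then some b else none) (erase s x) : Fin (n + 1) → Option (ZMod 2)) := by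
  funext t
  refine Fin.cases ?_ (fun i => ?_) t <;> simp [erase]

/-- The part of a mass function on the words that begin with `b`. -/
def headSlice {n : ℕ} (μ : Bits (n + 1) → ℝ) (b : ZMod 2) : Bits n → ℝ := fun x => μ (Fin.cons b x)

theorem sum_zmod_two (f : ZMod 2 → ℝ) : ∑ b, f b = f 0 + f 1 := Fin.sum_univ_two f

theorem sum_headSlice {n : ℕ} (μ : Bits (n + 1) → ℝ) :
    ∑ x, μ x = ∑ x, headSlice μ 0 x + ∑ x, headSlice μ 1 x := by
  rw [sum_fin_cons, sum_zmod_two]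
  rfl

theorem outputMass_cons {n : ℕ} (a : Bool) (s : Fin n → Bool) (μ : Bits (n + 1) → ℝ)
    (z : Option (ZMod 2)) (y : Fin n → Option (ZMod 2)) :
    outputMass (Fin.cons a s : Fin (n + 1) → Bool) μ (Fin.cons z y)
      = (if (if a then some 0 else none) = z then outputMass s (headSlice μ 0) y else 0)
        + (if (if a then some 1 else none) = z then outputMass s (headSlice μ 1) y else 0) := by
  have h : ∀ b : ZMod 2, (∑ x : Bits n, if erase (Fin.cons a s : Fin (n + 1) → Bool)
        (Fin.cons b x : Bits (n + 1)) = (Fin.cons z y : Fin (n + 1) → Option (ZMod 2))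
        then μ (Fin.cons b x) else 0)
      = if (if a then some b else none) = z then outputMass s (headSlice μ b) y else 0 := by
    intro b
    simp only [erase_cons, Fin.cons_inj, ite_and, outputMass, headSlice]
    split_ifs <;> simp
  rw [outputMass, sum_fin_cons, sum_zmod_two, h, h]

theorem sum_option_zmod_two (f : Option (ZMod 2) → ℝ) :
    ∑ z, f z = f none + (f (some 0) + f (some 1)) := by
  rw [Fintype.sum_option, sum_zmod_two]

/-- Chain rule: the last bracket is the entropy of the visible first symbol. Unnormalised masses
avoid conditioning on that symbol. -/
theorem outputEntropy_cons_true {n : ℕ} (s : Fin n → Bool) (μ : Bits (n + 1) → ℝ) :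
    outputEntropy (Fin.cons true s : Fin (n + 1) → Bool) μ
      = outputEntropy s (headSlice μ 0) + outputEntropy s (headSlice μ 1)
        + (Real.negMulLog (∑ x, headSlice μ 0 x) + Real.negMulLog (∑ x, headSlice μ 1 x)
          - Real.negMulLog (∑ x, headSlice μ 0 x + ∑ x, headSlice μ 1 x)) := by
  simp only [outputEntropy]
  rw [sum_fin_cons, sum_option_zmod_two, ← sum_headSlice]
  simp only [outputMass_cons]
  simp
  ring

theorem outputEntropy_cons_false {n : ℕ} (s : Fin n → Bool) (μ : Bits (n + 1) → ℝ) :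
    outputEntropy (Fin.cons false s : Fin (n + 1) → Bool) μ
      = outputEntropy s (headSlice μ 0 + headSlice μ 1) := by
  simp only [outputEntropy]
  rw [sum_fin_cons, sum_option_zmod_two, sum_headSlice]
  simp only [outputMass_cons, outputMass_add]
  simp [Finset.sum_add_distrib]

/-- Thinning the erasure pattern by a factor `1 - q` lowers the mean output entropy by at most this
factor. -/
theorem mul_outputEntropy_le_patternMean {q : ℝ} (hq0 : 0 ≤ q) (hq1 : q ≤ 1) :
    ∀ {n : ℕ} (s : Fin n → Bool) (μ : Bits n → ℝ), (∀ x, 0 ≤ μ x) →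
      (1 - q) * outputEntropy s μ
        ≤ patternMean q fun r => outputEntropy (fun t => s t && r t) μ := by
  intro n
  induction n with
  | zero =>
    intro s μ _
    have h : ∀ s' : Fin 0 → Bool, outputEntropy s' μ = 0 := by
      intro s'
      simp only [outputEntropy, outputMass, Fintype.sum_unique]
      rw [if_pos (Subsingleton.elim _ _), sub_self]
    simp [h, patternMean]
  | succ n ih =>
    intro s μ hμ
    have hμ' : ∀ b x, 0 ≤ headSlice μ b x := fun b x => hμ _
    obtain ⟨a, s, rfl⟩ : ∃ a s', s = (Fin.cons a s' : Fin (n + 1) → Bool) :=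
      ⟨s 0, Fin.tail s, (Fin.cons_self_tail s).symm⟩
    have hc : ∀ (b : Bool) (r : Fin n → Bool),
        (fun t => (Fin.cons a s : Fin (n + 1) → Bool) t && (Fin.cons b r : Fin (n + 1) → Bool) t)
          = (Fin.cons (a && b) (fun t => s t && r t) : Fin (n + 1) → Bool) := by
      intro b r
      funext t
      refine Fin.cases ?_ (fun i => ?_) t <;> simp
    rw [patternMean_succ]
    simp only [hc]
    -- If the first symbol is already erased, thinning acts on the merged slices alone. If it is
    -- visible, it survives with probability `1 - q` and keeps its own entropy; when it is lost, the
    -- slices merge, and superadditivity still leaves at least the two slice entropies, which the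
    -- induction hypothesis bounds.
    cases a
    · simp only [Bool.false_and, outputEntropy_cons_false]
      have := ih s (headSlice μ 0 + headSlice μ 1)
        fun x => add_nonneg (hμ' 0 x) (hμ' 1 x)
      linarith
    · simp only [Bool.and_true, Bool.and_false, outputEntropy_cons_false, outputEntropy_cons_true]
      have h0 := ih s (headSlice μ 0) (hμ' 0)
      have h1 := ih s (headSlice μ 1) (hμ' 1)
      have h2 : patternMean q (fun r => outputEntropy (fun t => s t && r t) (headSlice μ 0))
          + patternMean q (fun r => outputEntropy (fun t => s t && r t) (headSlice μ 1))
          ≤ patternMean q (fun r =>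
            outputEntropy (fun t => s t && r t) (headSlice μ 0 + headSlice μ 1)) := by
        rw [← patternMean_add]
        exact patternMean_mono hq0 hq1 fun r => outputEntropy_superadditive _ (hμ' 0) (hμ' 1)
      simp only [patternMean_add, patternMean_const]
      have h3 := mul_le_mul_of_nonneg_left h2 hq0
      linarith

/-! ### Entropy and decodability. -/

/-- Law of `f w` for a uniform word `w`. -/
noncomputable def lawMass {m : ℕ} {Y : Type*} [DecidableEq Y] (f : Bits m → Y) (y : Y) : ℝ :=
  (1 / 2 : ℝ) ^ m * ((Finset.univ.filter fun w => f w = y).card : ℝ)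

theorem lawMass_nonneg {m : ℕ} {Y : Type*} [DecidableEq Y] (f : Bits m → Y) (y : Y) :
    0 ≤ lawMass f y := by
  unfold lawMass; positivity

theorem sum_lawMass_mul {m : ℕ} {Y : Type*} [DecidableEq Y] [Fintype Y] (f : Bits m → Y)
    (g : Y → ℝ) : ∑ y, lawMass f y * g y = (1 / 2 : ℝ) ^ m * ∑ w, g (f w) := by
  have h : ∀ y, lawMass f y * g y
      = (1 / 2 : ℝ) ^ m * ∑ w, if f w = y then g y else 0 := by
    intro y
    rw [lawMass, mul_assoc, Finset.card_filter]
    push_cast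
    rw [Finset.sum_mul]
    simp
  simp_rw [h, ← Finset.mul_sum]
  rw [Finset.sum_comm]
  simp

theorem sum_lawMass {m : ℕ} {Y : Type*} [DecidableEq Y] [Fintype Y] (f : Bits m → Y) :
    ∑ y, lawMass f y = 1 := by
  have := sum_lawMass_mul f (fun _ => 1)
  simpa using this

theorem outputMass_lawMass {m n : ℕ} (s : Fin n → Bool) (x : Bits m → Bits n)
    (y : Fin n → Option (ZMod 2)) :
    outputMass s (lawMass x) y = lawMass (fun w => erase s (x w)) y := by
  have := sum_lawMass_mul x (fun z => if erase s z = y then 1 else 0)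
  simp only [mul_ite, mul_one, mul_zero] at this
  rw [outputMass, this, lawMass, Finset.card_filter]
  push_cast
  rfl

theorem outputEntropy_lawMass {m n : ℕ} (s : Fin n → Bool) (x : Bits m → Bits n) :
    outputEntropy s (lawMass x)
      = ∑ y, Real.negMulLog (lawMass (fun w => erase s (x w)) y) := by
  simp [outputEntropy, outputMass_lawMass, sum_lawMass]

/-- Fano's inequality on one fibre: `N` words share an observation and `c` of them are decoded
correctly. For `c = 0` it is log N ≤ m log 2; for `c = 1` one term log N is split off and bounded by
N - 1. -/
theorem mul_log_le_of_le_two_pow {c N m : ℕ} (hc1 : c ≤ 1) (hcN : c ≤ N) (hN : N ≤ 2 ^ m) :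
    (N : ℝ) * Real.log N ≤ ((N : ℝ) - c) * (m * Real.log 2 + 1) := by
  rcases Nat.eq_zero_or_pos N with rfl | hpos
  · obtain rfl : c = 0 := by omega
    simp
  have hN0 : (1 : ℝ) ≤ N := by exact_mod_cast hpos
  have h1 : Real.log N ≤ m * Real.log 2 := by
    rw [← Real.log_pow]
    exact Real.log_le_log (by linarith) (by exact_mod_cast hN)
  have h2 : Real.log N ≤ N - 1 := Real.log_le_sub_one_of_pos (by linarith)
  have h3 : 0 ≤ Real.log N := Real.log_nonneg hN0
  interval_cases c
  · push_cast; nlinarith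
  · push_cast; nlinarith

/-- An observation from which a uniform word can be recovered with small error probability has
large entropy. -/
theorem le_entropy_of_decoder {m : ℕ} {Y : Type*} [DecidableEq Y] [Fintype Y] (f : Bits m → Y)
    (d : Y → Bits m) :
    m * Real.log 2
        - ((1 / 2 : ℝ) ^ m * ∑ w, if d (f w) = w then (0 : ℝ) else 1) * (m * Real.log 2 + 1)
      ≤ ∑ y, Real.negMulLog (lawMass f y) := by
  set N : Y → ℕ := fun y => (Finset.univ.filter fun w => f w = y).card with hN
  set C : Y → ℕ := fun y => (Finset.univ.filter fun w => f w = y ∧ d (f w) = w).card with hC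
  have hCN : ∀ y, C y ≤ N y := fun y =>
    Finset.card_le_card fun w hw => by
      simp only [Finset.mem_filter] at hw ⊢
      exact ⟨hw.1, hw.2.1⟩
  have hC1 : ∀ y, C y ≤ 1 := fun y => by
    refine Finset.card_le_one.2 fun a ha b hb => ?_
    simp only [Finset.mem_filter, Finset.mem_univ, true_and] at ha hb
    rw [← ha.2, ← hb.2, ha.1, hb.1]
  have hN2 : ∀ y, N y ≤ 2 ^ m := fun y => by
    refine (Finset.card_le_univ _).trans ?_
    simp
  have hlow : ∀ y, (1 / 2 : ℝ) ^ m * (N y * (m * Real.log 2)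
      - ((N y : ℝ) - C y) * (m * Real.log 2 + 1)) ≤ Real.negMulLog (lawMass f y) := by
    intro y
    have h : Real.negMulLog (lawMass f y)
        = (1 / 2 : ℝ) ^ m * (N y * (m * Real.log 2) - N y * Real.log (N y)) := by
      rw [lawMass, Real.negMulLog]
      rcases Nat.eq_zero_or_pos (N y) with h0 | h0
      · have h0' : (Finset.univ.filter fun w => f w = y).card = 0 := h0
        simp [h0, h0']
      · have h1 : ((N y : ℕ) : ℝ) ≠ 0 := by positivity
        rw [Real.log_mul (by positivity) h1, Real.log_pow, one_div, Real.log_inv]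
        ring
    rw [h]
    refine mul_le_mul_of_nonneg_left ?_ (by positivity)
    have := mul_log_le_of_le_two_pow (hC1 y) (hCN y) (hN2 y)
    linarith
  refine le_trans (le_of_eq ?_) (Finset.sum_le_sum fun y _ => hlow y)
  have hsN : ∑ y, (N y : ℝ) = ∑ w : Bits m, (1 : ℝ) := by
    simp only [hN, Finset.card_filter]
    push_cast
    rw [Finset.sum_comm]
    simp
  have hsC : ∑ y, (C y : ℝ) = ∑ w : Bits m, if d (f w) = w then (1 : ℝ) else 0 := by
    simp only [hC, Finset.card_filter, ite_and]
    push_cast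
    rw [Finset.sum_comm]
    simp
  have hbad : ∑ w : Bits m, (if d (f w) = w then (0 : ℝ) else 1)
      = ∑ w : Bits m, (1 : ℝ) - ∑ w : Bits m, if d (f w) = w then (1 : ℝ) else 0 := by
    rw [← Finset.sum_sub_distrib]
    exact Finset.sum_congr rfl fun w _ => by split_ifs <;> simp
  have hone : (1 / 2 : ℝ) ^ m * ∑ w : Bits m, (1 : ℝ) = 1 := by simp
  rw [← Finset.mul_sum, Finset.sum_sub_distrib, ← Finset.sum_mul, ← Finset.sum_mul,
    Finset.sum_sub_distrib, hsN, hsC, hbad]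
  linear_combination (-(m * Real.log 2)) * hone

theorem messageMean_sub {m₁ m₂ : ℕ} (f g : Bits m₁ → Bits m₂ → ℝ) :
    messageMean (fun w₁ w₂ => f w₁ w₂ - g w₁ w₂) = messageMean f - messageMean g := by
  simp only [messageMean, Finset.sum_sub_distrib, mul_sub]

theorem messageMean_mul_const {m₁ m₂ : ℕ} (f : Bits m₁ → Bits m₂ → ℝ) (c : ℝ) :
    messageMean (fun w₁ w₂ => f w₁ w₂ * c) = messageMean f * c := by
  simp only [messageMean, ← Finset.sum_mul, mul_assoc]

/-- If a uniform word can be recovered with small error probability from an observation with few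
values, then the mean conditional entropy of the observation given the word is small. -/
theorem entropy_le_of_decoder {m₁ m₂ k : ℕ} {Y : Type*} [DecidableEq Y] [Fintype Y]
    (f : Bits m₁ → Bits m₂ → Y) (T : Finset Y) (hT : T.card ≤ 2 ^ k) (hf : ∀ w₁ w₂, f w₁ w₂ ∈ T)
    (d : Y → Bits m₂) :
    (1 / 2 : ℝ) ^ m₂ * ∑ w₂, ∑ y, Real.negMulLog (lawMass (fun w₁ => f w₁ w₂) y)
      ≤ k * Real.log 2
        - (1 - messageMean fun w₁ w₂ => if d (f w₁ w₂) = w₂ then (0 : ℝ) else 1)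
          * (m₂ * Real.log 2) + 2 := by
  -- Gibbs' inequality against the reference mass 2^(-k) on `T`, raised by the factor 2^(m₂) where
  -- the decoder names `w₂`. Each value is raised for a single `w₂`, so the terms added here average
  -- to at most 2, the additive constant of the conclusion.
  have hup : ∀ w₂ y, Real.negMulLog (lawMass (fun w₁ => f w₁ w₂) y)
      ≤ lawMass (fun w₁ => f w₁ w₂) y
          * (k * Real.log 2 - if d y = w₂ then m₂ * Real.log 2 else 0)
        + if y ∈ T then ((1 / 2 : ℝ) ^ k + if d y = w₂ then 2 ^ m₂ * (1 / 2 : ℝ) ^ k else 0)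
          else 0 := by
    intro w₂ y
    have h0 := lawMass_nonneg (fun w₁ => f w₁ w₂) y
    by_cases hy : y ∈ T
    · rw [if_pos hy]
      have hk : (0 : ℝ) < (1 / 2) ^ k := by positivity
      split_ifs with hd
      · have := negMulLog_le h0 (q := 2 ^ m₂ * (1 / 2 : ℝ) ^ k) (by positivity)
        rw [Real.log_mul (by positivity) (by positivity), Real.log_pow, Real.log_pow, one_div,
          Real.log_inv] at this
        rw [one_div] at hk ⊢
        linarith
      · have := negMulLog_le h0 hk
        rw [Real.log_pow, one_div, Real.log_inv] at this
        rw [one_div]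
        linarith
    · have : lawMass (fun w₁ => f w₁ w₂) y = 0 := by
        rw [lawMass, Finset.filter_eq_empty_iff.2]
        · simp
        · rintro w₁ - h
          exact hy (h ▸ hf w₁ w₂)
      simp [this, hy]
  have hT' : (T.card : ℝ) * (1 / 2 : ℝ) ^ k ≤ 1 := by
    have : (T.card : ℝ) ≤ 2 ^ k := by exact_mod_cast hT
    calc (T.card : ℝ) * (1 / 2 : ℝ) ^ k ≤ 2 ^ k * (1 / 2 : ℝ) ^ k :=
          mul_le_mul_of_nonneg_right this (by positivity)
      _ = 1 := by rw [← mul_pow]; norm_num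
  have htwo : (1 / 2 : ℝ) ^ m₂ * 2 ^ m₂ = 1 := by rw [← mul_pow]; norm_num
  have hq : (1 / 2 : ℝ) ^ m₂ * ∑ w₂ : Bits m₂, ∑ y, (if y ∈ T then
      ((1 / 2 : ℝ) ^ k + if d y = w₂ then 2 ^ m₂ * (1 / 2 : ℝ) ^ k else 0) else 0) ≤ 2 := by
    rw [Finset.sum_comm]
    have : ∀ y, ∑ w₂ : Bits m₂, (if y ∈ T then
      ((1 / 2 : ℝ) ^ k + if d y = w₂ then 2 ^ m₂ * (1 / 2 : ℝ) ^ k else 0) else 0)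
      = if y ∈ T then 2 ^ m₂ * (1 / 2 : ℝ) ^ k + 2 ^ m₂ * (1 / 2 : ℝ) ^ k else 0 := by
      intro y
      split_ifs with hy
      · rw [Finset.sum_add_distrib]
        simp
      · simp
    simp_rw [this]
    rw [Finset.sum_ite_mem, Finset.univ_inter, Finset.sum_const, nsmul_eq_mul]
    calc _ = ((1 / 2 : ℝ) ^ m₂ * 2 ^ m₂) * (2 * (T.card * (1 / 2 : ℝ) ^ k)) := by ring
      _ ≤ 2 := by rw [htwo]; linarith
  have hmain : (1 / 2 : ℝ) ^ m₂ * ∑ w₂, ∑ y, lawMass (fun w₁ => f w₁ w₂) y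
      * (k * Real.log 2 - if d y = w₂ then m₂ * Real.log 2 else 0)
      = k * Real.log 2
        - (1 - messageMean fun w₁ w₂ => if d (f w₁ w₂) = w₂ then (0 : ℝ) else 1)
          * (m₂ * Real.log 2) := by
    simp_rw [fun w₂ => sum_lawMass_mul (fun w₁ => f w₁ w₂)
      (fun y => k * Real.log 2 - if d y = w₂ then m₂ * Real.log 2 else 0)]
    have h1 : (fun (w₁ : Bits m₁) (w₂ : Bits m₂) =>
          k * Real.log 2 - if d (f w₁ w₂) = w₂ then m₂ * Real.log 2 else 0)
        = fun w₁ w₂ => k * Real.log 2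
          - (1 - if d (f w₁ w₂) = w₂ then (0 : ℝ) else 1) * (m₂ * Real.log 2) := by
      funext w₁ w₂
      split_ifs <;> simp
    have h2 : messageMean (fun (w₁ : Bits m₁) (w₂ : Bits m₂) =>
          k * Real.log 2 - if d (f w₁ w₂) = w₂ then m₂ * Real.log 2 else 0)
        = k * Real.log 2
        - (1 - messageMean fun w₁ w₂ => if d (f w₁ w₂) = w₂ then (0 : ℝ) else 1)
          * (m₂ * Real.log 2) := by
      rw [h1, messageMean_sub, messageMean_const, messageMean_mul_const, messageMean_one_sub]
    rw [← h2, ← messageMean_swap, messageMean, ← Finset.mul_sum, mul_assoc]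
  calc _ ≤ (1 / 2 : ℝ) ^ m₂ * ∑ w₂, ∑ y, _ := mul_le_mul_of_nonneg_left
        (Finset.sum_le_sum fun w₂ _ => Finset.sum_le_sum fun y _ => hup w₂ y) (by positivity)
    _ = _ := by simp only [Finset.sum_add_distrib, mul_add]; rfl
    _ ≤ _ := by rw [hmain]; linarith

/-- The converse of time sharing for a degraded channel whose weaker receiver has no cache. -/
theorem NonBlindCode.weighted_rate_bound {n m₁ m₂ : ℕ} (c : NonBlindCode n m₁ m₂) {δ₁ δ₂ ε₁ : ℝ}
    (hδ₁ : 0 ≤ δ₁ ∧ δ₁ < 1) (hδ₂ : δ₂ < 1) (hδ : δ₁ ≤ δ₂) (hε₁ : 0 ≤ ε₁ ∧ ε₁ ≤ 1) :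
    (1 - δ₂) / (1 - δ₁) * (m₁ * Real.log 2 - c.err₁ δ₁ δ₂ ε₁ 1 * (m₁ * Real.log 2 + 1))
      ≤ n * (1 - δ₂) * Real.log 2 - (1 - c.err₂ δ₁ δ₂ ε₁ 1) * (m₂ * Real.log 2) + 2 := by
  have hpos : 0 < 1 - δ₁ := by linarith [hδ₁.2]
  set q : ℝ := (δ₂ - δ₁) / (1 - δ₁) with hq
  have hq0 : 0 ≤ q := div_nonneg (by linarith) hpos.le
  have hq1 : q ≤ 1 := (div_le_one hpos).2 (by linarith)
  have hq3 : (1 - δ₂) / (1 - δ₁) = 1 - q := by rw [hq]; field_simp; ring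
  have hq2 : 1 - δ₂ = (1 - δ₁) * (1 - q) := by rw [← hq3]; field_simp
  have hδ₂0 : 0 ≤ δ₂ := hδ₁.1.trans hδ
  rw [hq3, c.err₁_eq, c.err₂_eq]
  simp_rw [patternMean_of_eq_one]
  set off : Fin m₁ → Bool := fun _ => false
  -- The conditional entropy, given message 2, of the output through `s`. Given `w₂`, receiver 1's
  -- cached bits are constant, so its decoder depends on the output only.
  set J : (Fin n → Bool) → (Fin m₂ → Bool) → ℝ := fun s e₁ => (1 / 2 : ℝ) ^ m₂ * ∑ w₂,
    outputEntropy s (lawMass fun w₁ => c.enc w₁ w₂ e₁ off) with hJ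
  have h1 : ∀ s e₁, m₁ * Real.log 2 - (messageMean fun w₁ w₂ =>
      if c.dec₁ (erase s (c.enc w₁ w₂ e₁ off)) (erase e₁ w₂) = w₁ then (0 : ℝ) else 1)
        * (m₁ * Real.log 2 + 1) ≤ J s e₁ := by
    intro s e₁
    have h : ∀ w₂, _ := fun w₂ => le_entropy_of_decoder
      (fun w₁ => erase s (c.enc w₁ w₂ e₁ off)) (fun y => c.dec₁ y (erase e₁ w₂))
    have h' := mul_le_mul_of_nonneg_left (Finset.sum_le_sum fun w₂ (_ : w₂ ∈ Finset.univ) => h w₂)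
      (show (0 : ℝ) ≤ (1 / 2) ^ m₂ by positivity)
    simp only [hJ, outputEntropy_lawMass]
    refine le_trans (le_of_eq ?_) h'
    generalize (m₁ : ℝ) * Real.log 2 = M
    rw [Finset.sum_sub_distrib, ← Finset.sum_mul, ← Finset.mul_sum, mul_sub, ← messageMean_swap,
      messageMean]
    simp
    ring
  have h2 : ∀ s e₁, J s e₁ ≤ onCount s * Real.log 2 - (1 - messageMean fun w₁ w₂ =>
      if c.dec₂ (erase s (c.enc w₁ w₂ e₁ off)) (erase off w₁) = w₂ then (0 : ℝ) else 1)
        * (m₂ * Real.log 2) + 2 := by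
    intro s e₁
    have hoff : ∀ w₁, erase off w₁ = fun _ => none := fun w₁ => by funext t; simp [erase, off]
    have h := entropy_le_of_decoder (fun w₁ w₂ => erase s (c.enc w₁ w₂ e₁ off))
      (Finset.univ.image (erase s)) (card_image_erase_le s)
      (fun w₁ w₂ => Finset.mem_image_of_mem _ (Finset.mem_univ _))
      (fun y => c.dec₂ y fun _ => none)
    simpa only [hJ, outputEntropy_lawMass, hoff] using h
  have h3 : ∀ s e₁, (1 - q) * J s e₁ ≤ patternMean q fun r => J (fun t => s t && r t) e₁ := by
    intro s e₁
    simp only [hJ]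
    rw [patternMean_const_mul, patternMean_sum, mul_left_comm, Finset.mul_sum]
    exact mul_le_mul_of_nonneg_left (Finset.sum_le_sum fun w₂ _ =>
      mul_outputEntropy_le_patternMean hq0 hq1 s _ fun x => lawMass_nonneg _ x) (by positivity)
  have h4 : (1 - q) * patternMean δ₁ (fun s => patternMean ε₁ fun e₁ => J s e₁)
      ≤ patternMean δ₂ fun s => patternMean ε₁ fun e₁ => J s e₁ := by
    rw [← patternMean_and δ₁ q δ₂ hq2 fun s => patternMean ε₁ fun e₁ => J s e₁,
      ← patternMean_const_mul]
    refine patternMean_mono hδ₁.1 hδ₁.2.le fun s => ?_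
    rw [← patternMean_const_mul, patternMean_comm]
    exact patternMean_mono hε₁.1 hε₁.2 fun e₁ => h3 s e₁
  have h5 := patternMean_mono hδ₁.1 hδ₁.2.le fun s => patternMean_mono hε₁.1 hε₁.2 fun e₁ => h1 s e₁
  have h6 := patternMean_mono hδ₂0 hδ₂.le fun s => patternMean_mono hε₁.1 hε₁.2 fun e₁ => h2 s e₁
  simp_rw [patternMean_add, patternMean_sub, patternMean_mul_const, patternMean_sub,
    patternMean_const, patternMean_onCount] at h5 h6
  exact (mul_le_mul_of_nonneg_left h5 (by linarith)).trans (h4.trans h6)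

/-! ### From finite block length to the outer bound on rates. -/

theorem tendsto_ceil_mul_div {R : ℝ} (hR : 0 ≤ R) :
    Tendsto (fun n : ℕ => (⌈(n : ℝ) * R⌉₊ : ℝ) / n) atTop (𝓝 R) := by
  have h := (tendsto_nat_ceil_mul_div_atTop hR).comp (tendsto_natCast_atTop_atTop (R := ℝ))
  refine h.congr fun n => ?_
  simp [mul_comm]

theorem tendsto_const_div_natCast (c : ℝ) : Tendsto (fun n : ℕ => c / n) atTop (𝓝 0) :=
  tendsto_const_div_atTop_nhds_zero_nat c

theorem NonBlindAchievable.swap {δ₁ δ₂ ε₁ ε₂ : ℝ} {R : ℝ × ℝ}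
    (h : NonBlindAchievable δ₁ δ₂ ε₁ ε₂ R) : NonBlindAchievable δ₂ δ₁ ε₂ ε₁ R.swap := by
  obtain ⟨h1, h2, c, hc1, hc2⟩ := h
  refine ⟨h2, h1, fun n => (c n).swap, ?_, ?_⟩
  · simpa only [NonBlindCode.err₁_swap] using hc2
  · simpa only [NonBlindCode.err₂_swap] using hc1

theorem NonBlindAchievable.sum_rate_le {δ₁ δ₂ ε₁ ε₂ : ℝ} {R : ℝ × ℝ}
    (hδ₁ : 0 ≤ δ₁ ∧ δ₁ < 1) (hδ₂ : δ₂ < 1) (hδ : δ₁ ≤ δ₂)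
    (hε₁ : 0 ≤ ε₁ ∧ ε₁ ≤ 1) (hε₂ : 0 ≤ ε₂ ∧ ε₂ ≤ 1)
    (h : NonBlindAchievable δ₁ δ₂ ε₁ ε₂ R) : R.1 + ε₁ * R.2 ≤ 1 - δ₁ := by
  obtain ⟨h1, h2, c, hc1, hc2⟩ := h
  have hl : 0 < Real.log 2 := Real.log_pos (by norm_num)
  have t1 := tendsto_ceil_mul_div h1
  have t2 := tendsto_ceil_mul_div h2
  have hL := (((tendsto_const_nhds (x := (1 : ℝ))).sub hc1).sub hc2).mul (t1.add t2)
  have hR := ((tendsto_const_nhds (x := 1 - δ₁)).add (t2.mul_const (1 - ε₁))).add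
    (tendsto_const_div_natCast (1 / Real.log 2))
  have := le_of_tendsto_of_tendsto hL hR (by
    filter_upwards [eventually_gt_atTop 0] with n hn
    have hb := (c n).sum_rate_bound hδ₁ hδ₂ hδ hε₁ hε₂
    have hn' : (0 : ℝ) < n := by exact_mod_cast hn
    have hb2 := div_le_div_of_nonneg_right hb (mul_pos hn' hl).le
    refine le_trans (le_of_eq ?_) (hb2.trans (le_of_eq ?_)) <;> field_simp)
  linarith

theorem NonBlindAchievable.single_rate_le {δ₁ δ₂ ε₁ ε₂ : ℝ} {R : ℝ × ℝ}
    (hδ₂ : 0 ≤ δ₂ ∧ δ₂ ≤ 1) (hε₁ : 0 ≤ ε₁ ∧ ε₁ ≤ 1) (hε₂ : 0 ≤ ε₂ ∧ ε₂ ≤ 1)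
    (h : NonBlindAchievable δ₁ δ₂ ε₁ ε₂ R) : R.2 ≤ 1 - δ₂ := by
  obtain ⟨h1, h2, c, -, hc2⟩ := h
  have hl : 0 < Real.log 2 := Real.log_pos (by norm_num)
  have t1 := tendsto_ceil_mul_div h1
  have t2 := tendsto_ceil_mul_div h2
  have hL := ((tendsto_const_nhds (x := (1 : ℝ))).sub hc2).mul (t1.add t2)
  have hR := (t1.add (tendsto_const_nhds (x := 1 - δ₂))).add
    (tendsto_const_div_natCast (1 / Real.log 2))
  have := le_of_tendsto_of_tendsto hL hR (by
    filter_upwards [eventually_gt_atTop 0] with n hn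
    have hb := (c n).single_rate_bound (δ₁ := δ₁) hδ₂ hε₁ hε₂
    have hn' : (0 : ℝ) < n := by exact_mod_cast hn
    have hb2 := div_le_div_of_nonneg_right hb (mul_pos hn' hl).le
    refine le_trans (le_of_eq ?_) (hb2.trans (le_of_eq ?_)) <;> field_simp)
  linarith

theorem NonBlindAchievable.weighted_rate_le {δ₁ δ₂ ε₁ : ℝ} {R : ℝ × ℝ}
    (hδ₁ : 0 ≤ δ₁ ∧ δ₁ < 1) (hδ₂ : δ₂ < 1) (hδ : δ₁ ≤ δ₂) (hε₁ : 0 ≤ ε₁ ∧ ε₁ ≤ 1)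
    (h : NonBlindAchievable δ₁ δ₂ ε₁ 1 R) : (1 - δ₂) / (1 - δ₁) * R.1 + R.2 ≤ 1 - δ₂ := by
  obtain ⟨h1, h2, c, hc1, hc2⟩ := h
  have hl : 0 < Real.log 2 := Real.log_pos (by norm_num)
  have t1 := tendsto_ceil_mul_div h1
  have t2 := tendsto_ceil_mul_div h2
  have hL := (t1.sub (hc1.mul (t1.add (tendsto_const_div_natCast (1 / Real.log 2))))).const_mul
    ((1 - δ₂) / (1 - δ₁))
  have hR := ((tendsto_const_nhds (x := 1 - δ₂)).sub
    (((tendsto_const_nhds (x := (1 : ℝ))).sub hc2).mul t2)).add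
    (tendsto_const_div_natCast (2 / Real.log 2))
  have := le_of_tendsto_of_tendsto hL hR (by
    filter_upwards [eventually_gt_atTop 0] with n hn
    have hb := (c n).weighted_rate_bound hδ₁ hδ₂ hδ hε₁
    have hn' : (0 : ℝ) < n := by exact_mod_cast hn
    have hb2 := div_le_div_of_nonneg_right hb (mul_pos hn' hl).le
    refine le_trans (le_of_eq ?_) (hb2.trans (le_of_eq ?_))
    · rw [mul_div_assoc]
      congr 1
      field_simp
    · field_simp)
  linarith

theorem isClosed_rateRegion (δ₁ δ₂ ε₁ ε₂ : ℝ) : IsClosed (rateRegion δ₁ δ₂ ε₁ ε₂) := by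
  unfold rateRegion
  refine IsClosed.and (isClosed_le ?_ ?_) (IsClosed.and (isClosed_le ?_ ?_)
    (IsClosed.and (isClosed_le ?_ ?_) (isClosed_le ?_ ?_))) <;> fun_prop

/-- As δ₁ ≤ δ₂, the minima give β₂ = ε₁ and β₁ = ε₂(1 - δ₂)/(1 - δ₁), so the second constraint is
the sum-rate bound. The first is the single-rate bound for ε₂ = 0, the entropy bound for ε₂ = 1, and
the sum-rate bound with receivers exchanged in the symmetric setting. -/
theorem nonBlindCapacity_subset_rateRegion {δ₁ δ₂ ε₁ ε₂ : ℝ}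
    (hδ₁ : 0 ≤ δ₁ ∧ δ₁ < 1) (hδ₂ : 0 ≤ δ₂ ∧ δ₂ < 1)
    (hε₁ : 0 ≤ ε₁ ∧ ε₁ ≤ 1) (hε₂ : 0 ≤ ε₂ ∧ ε₂ ≤ 1)
    (h : (δ₁ ≤ δ₂ ∧ (ε₂ = 0 ∨ ε₂ = 1)) ∨ (δ₁ = δ₂ ∧ ε₁ = ε₂)) :
    nonBlindCapacity δ₁ δ₂ ε₁ ε₂ ⊆ rateRegion δ₁ δ₂ ε₁ ε₂ := by
  refine closure_minimal (fun R hR => ?_) (isClosed_rateRegion _ _ _ _)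
  have hR' : NonBlindAchievable δ₁ δ₂ ε₁ ε₂ R := hR
  have hp₁ : 0 < 1 - δ₁ := by linarith [hδ₁.2]
  have hp₂ : 0 < 1 - δ₂ := by linarith [hδ₂.2]
  have hle : δ₁ ≤ δ₂ := by
    rcases h with h | h
    · exact h.1
    · exact h.1.le
  have hmin : min ((1 - δ₁) / (1 - δ₂)) 1 = 1 :=
    min_eq_right ((one_le_div hp₂).2 (by linarith))
  have hmin' : min ((1 - δ₂) / (1 - δ₁)) 1 = (1 - δ₂) / (1 - δ₁) :=
    min_eq_left ((div_le_one hp₁).2 (by linarith))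
  refine ⟨hR'.1, hR'.2.1, ?_, ?_⟩
  · rw [hmin']
    rcases h with ⟨hle, rfl | rfl⟩ | ⟨rfl, rfl⟩
    · simpa using hR'.single_rate_le ⟨hδ₂.1, hδ₂.2.le⟩ hε₁ hε₂
    · simpa using hR'.weighted_rate_le hδ₁ hδ₂.2 hle hε₁
    · have := hR'.swap.sum_rate_le hδ₁ hδ₁.2 le_rfl hε₁ hε₁
      rw [div_self hp₁.ne', mul_one, add_comm]
      exact this
  · rw [hmin, mul_one]
    exact hR'.sum_rate_le hδ₁ hδ₂.2 hle hε₁ hε₂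

theorem blindCapacity_subset_nonBlindCapacity (δ₁ δ₂ ε₁ ε₂ : ℝ) :
    blindCapacity δ₁ δ₂ ε₁ ε₂ ⊆ nonBlindCapacity δ₁ δ₂ ε₁ ε₂ :=
  closure_mono fun _ ⟨h1, h2, c, hc1, hc2⟩ => ⟨h1, h2, fun n => (c n).toNonBlind, hc1, hc2⟩

/-! ### Uniform means and random binary matrices. -/

/-- Mean over a uniformly distributed element of a finite type. -/
noncomputable def uniformMean {α : Type*} [Fintype α] (F : α → ℝ) : ℝ :=
  (∑ a, F a) / Fintype.card α

section uniformMean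

variable {α β : Type*} [Fintype α] [Fintype β]

theorem uniformMean_mono {F G : α → ℝ} (h : ∀ a, F a ≤ G a) : uniformMean F ≤ uniformMean G :=
  div_le_div_of_nonneg_right (Finset.sum_le_sum fun a _ => h a) (Nat.cast_nonneg _)

theorem uniformMean_const [Nonempty α] (c : ℝ) : uniformMean (fun _ : α => c) = c := by
  simp [uniformMean]

theorem uniformMean_add (F G : α → ℝ) :
    uniformMean (fun a => F a + G a) = uniformMean F + uniformMean G := by
  simp [uniformMean, Finset.sum_add_distrib, add_div]

theorem uniformMean_sum {ι : Type*} (T : Finset ι) (F : ι → α → ℝ) :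
    uniformMean (fun a => ∑ i ∈ T, F i a) = ∑ i ∈ T, uniformMean (F i) := by
  simp only [uniformMean, ← Finset.sum_div]
  rw [Finset.sum_comm]

theorem uniformMean_comm (F : α → β → ℝ) :
    uniformMean (fun a => uniformMean fun b => F a b)
      = uniformMean fun b => uniformMean fun a => F a b := by
  simp only [uniformMean, ← Finset.sum_div]
  rw [Finset.sum_comm, div_div, div_div, mul_comm]

theorem uniformMean_patternMean {m : ℕ} (p : ℝ) (F : α → (Fin m → Bool) → ℝ) :
    uniformMean (fun a => patternMean p (F a)) = patternMean p fun s => uniformMean fun a => F a s := by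
  simp only [uniformMean, patternMean, mul_div_assoc', Finset.mul_sum, ← Finset.sum_div]
  rw [Finset.sum_comm]

/-- The probabilistic method: it extracts fixed matrices from random ensembles. -/
theorem exists_le_of_uniformMean_le [Nonempty α] {F : α → ℝ} {b : ℝ} (h : uniformMean F ≤ b) :
    ∃ a, F a ≤ b := by
  by_contra! hc
  have hpos : (0 : ℝ) < Fintype.card α := by exact_mod_cast Fintype.card_pos
  have := Finset.sum_lt_sum_of_nonempty Finset.univ_nonempty fun a (_ : a ∈ Finset.univ) => hc a
  rw [Finset.sum_const, nsmul_eq_mul, Finset.card_univ] at this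
  rw [uniformMean, div_le_iff₀ hpos] at h
  linarith

end uniformMean

open Classical in
/-- The indicator of a proposition. -/
noncomputable def ind (P : Prop) : ℝ := if P then 1 else 0

theorem ind_nonneg (P : Prop) : 0 ≤ ind P := by
  unfold ind; split_ifs <;> norm_num

theorem ind_le_one (P : Prop) : ind P ≤ 1 := by
  unfold ind; split_ifs <;> norm_num

theorem ind_of {P : Prop} (h : P) : ind P = 1 := if_pos h

theorem ind_of_not {P : Prop} (h : ¬P) : ind P = 0 := if_neg h

theorem ind_mono {P Q : Prop} (h : P → Q) : ind P ≤ ind Q := by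
  by_cases hP : P
  · rw [ind_of hP, ind_of (h hP)]
  · rw [ind_of_not hP]; exact ind_nonneg Q

theorem ind_exists_le {ι : Type*} (T : Finset ι) (P : ι → Prop) :
    ind (∃ i ∈ T, P i) ≤ ∑ i ∈ T, ind (P i) := by
  by_cases h : ∃ i ∈ T, P i
  · obtain ⟨i, hi, hP⟩ := h
    calc ind (∃ i ∈ T, P i) ≤ 1 := ind_le_one _
      _ = ind (P i) := (ind_of hP).symm
      _ ≤ _ := Finset.single_le_sum (fun j _ => ind_nonneg (P j)) hi
  · rw [ind_of_not h]
    exact Finset.sum_nonneg fun j _ => ind_nonneg _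

/-- A uniformly random binary matrix maps a fixed nonzero vector to a uniformly random vector. -/
theorem uniformMean_mulVec_eq_zero {κ ι : Type*} [Fintype κ] [Fintype ι] [DecidableEq κ]
    [DecidableEq ι] {v : ι → ZMod 2} (hv : v ≠ 0) (T : Finset κ) :
    uniformMean (fun A : Matrix κ ι (ZMod 2) => ind (∀ t ∈ T, A.mulVec v t = 0))
      = (1 / 2 : ℝ) ^ T.card := by
  obtain ⟨j, hj⟩ := Function.ne_iff.1 hv
  let φ : Matrix κ ι (ZMod 2) →+ ({t // t ∈ T} → ZMod 2) :=
    { toFun := fun A t => A.mulVec v t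
      map_zero' := by funext t; simp
      map_add' := fun A B => by funext t; simp [Matrix.add_mulVec] }
  have hφ : ∀ A t, φ A t = A.mulVec v t := fun _ _ => rfl
  have hsurj : Function.Surjective φ := by
    intro u
    -- A preimage of `u` supported in the single column `j`, where `v` is nonzero.
    refine ⟨Matrix.of fun t i => if h : t ∈ T then (if i = j then (v j)⁻¹ * u ⟨t, h⟩ else 0) else 0, ?_⟩
    funext t
    have ht : (t : κ) ∈ T := t.2
    rw [hφ]
    simp only [Matrix.mulVec, dotProduct, Matrix.of_apply, ht, dif_pos, ite_mul, zero_mul,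
      Finset.sum_ite_eq', Finset.mem_univ, if_true]
    rw [mul_right_comm, inv_mul_cancel₀ hj, one_mul]
  have hcard : Nat.card φ.ker * 2 ^ T.card = Fintype.card (Matrix κ ι (ZMod 2)) := by
    rw [← Nat.card_eq_fintype_card, ← φ.ker.card_mul_index, AddSubgroup.index_ker,
      AddMonoidHom.range_eq_top.2 hsurj]
    congr 1
    rw [Nat.card_congr AddSubgroup.topEquiv.toEquiv, Nat.card_eq_fintype_card, Fintype.card_fun,
      ZMod.card, Fintype.card_coe]
  have hsum : ∑ A : Matrix κ ι (ZMod 2), ind (∀ t ∈ T, A.mulVec v t = 0) = Nat.card φ.ker := by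
    classical
    rw [Nat.card_eq_fintype_card, Fintype.card_subtype, Finset.card_filter]
    push_cast
    refine Finset.sum_congr rfl fun A _ => ?_
    have hA : A ∈ φ.ker ↔ ∀ t ∈ T, A.mulVec v t = 0 := by
      rw [AddMonoidHom.mem_ker, funext_iff]
      simp [hφ]
    by_cases h : A ∈ φ.ker
    · rw [ind_of (hA.1 h), if_pos h]
    · rw [ind_of_not (mt hA.2 h), if_neg h]
  have hpos : (0 : ℝ) < Nat.card φ.ker := by exact_mod_cast Nat.card_pos
  rw [uniformMean, hsum, ← hcard]
  push_cast
  rw [one_div, inv_pow]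
  field_simp

/-- min(1, 2^x) ≤ e^(lx) for 0 ≤ l ≤ log 2. The exponential form factorises over pattern entries,
and a small tilt `l` then gives Chernoff bounds. -/
theorem min_one_le_exp {l u v x : ℝ} {a b : ℕ} (hl0 : 0 ≤ l) (hl1 : l ≤ Real.log 2)
    (hx1 : x ≤ 1) (hx : x ≤ 2 ^ a * (1 / 2 : ℝ) ^ b) (hu : u = a) (hv : v = b) :
    x ≤ Real.exp (l * (u - v)) := by
  subst hu hv
  rcases le_total (b : ℝ) a with h | h
  · exact hx1.trans (Real.one_le_exp (mul_nonneg hl0 (by linarith)))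
  · refine hx.trans ?_
    have : (2 : ℝ) ^ a * (1 / 2 : ℝ) ^ b = Real.exp (Real.log 2 * (a - b)) := by
      rw [show Real.log 2 * ((a : ℝ) - b) = a * Real.log 2 - b * Real.log 2 by ring, Real.exp_sub,
        Real.exp_nat_mul, Real.exp_nat_mul, Real.exp_log (by norm_num), one_div, inv_pow]
      rfl
    rw [this]
    refine Real.exp_le_exp.2 ?_
    nlinarith

/-! ### Chernoff estimates for erasure and cache counts. -/

theorem log_two_le_one : Real.log 2 ≤ 1 := by
  have := Real.log_two_lt_d9
  linarith

theorem exp_le_quadratic {x : ℝ} (hx : |x| ≤ 1) : Real.exp x ≤ 1 + x + x ^ 2 := by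
  have := (abs_le.1 (Real.abs_exp_sub_one_sub_id_le hx)).2
  linarith

/-- Chernoff bound for the number of unerased symbols at the positions in `I`. -/
theorem patternMean_exp_neg_le {n : ℕ} {δ l : ℝ} (hδ : 0 ≤ δ ∧ δ ≤ 1) (hl0 : 0 ≤ l) (hl1 : l ≤ 1)
    (I : Finset (Fin n)) :
    patternMean δ (fun s => Real.exp (-(l * ((I.filter fun t => s t = true).card : ℝ))))
      ≤ Real.exp (I.card * ((1 - δ) * (-l + l ^ 2))) := by
  have h1 : ∀ s : Fin n → Bool, Real.exp (-(l * ((I.filter fun t => s t = true).card : ℝ)))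
      = ∏ t, if t ∈ I then (if s t = true then Real.exp (-l) else 1) else 1 := by
    intro s
    rw [Finset.prod_ite_mem, Finset.univ_inter, Finset.prod_ite, Finset.prod_const, Finset.prod_const_one,
      mul_one, ← Real.exp_nat_mul]
    congr 1; ring
  simp_rw [h1]
  rw [patternMean_prod δ fun t b => if t ∈ I then (if b = true then Real.exp (-l) else 1) else 1]
  have h2 : ∀ t : Fin n, (1 - δ) * (if t ∈ I then (if true = true then Real.exp (-l) else 1) else 1)
      + δ * (if t ∈ I then (if false = true then Real.exp (-l) else 1) else 1)
      = if t ∈ I then (1 - δ) * Real.exp (-l) + δ else 1 := by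
    intro t; split_ifs <;> simp_all
  rw [Finset.prod_congr rfl fun t _ => h2 t, Finset.prod_ite_mem, Finset.univ_inter, Finset.prod_const, Real.exp_nat_mul]
  refine pow_le_pow_left₀ (add_nonneg (mul_nonneg (by linarith [hδ.2]) (Real.exp_pos _).le) hδ.1) ?_ _
  have h3 := exp_le_quadratic (x := -l) (by rw [abs_neg, abs_of_nonneg hl0]; exact hl1)
  have h4 := Real.add_one_le_exp ((1 - δ) * (-l + l ^ 2))
  have h5 := mul_le_mul_of_nonneg_left h3 (show 0 ≤ 1 - δ by linarith [hδ.2])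
  linarith

/-- Chernoff bound for the number of bits that are not cached. -/
theorem patternMean_exp_le {m : ℕ} {ε l : ℝ} (hε : 0 ≤ ε ∧ ε ≤ 1) (hl0 : 0 ≤ l) (hl1 : l ≤ 1) :
    patternMean (m := m) ε (fun e => Real.exp (l * (offCount e : ℝ)))
      ≤ Real.exp (m * (ε * (l + l ^ 2))) := by
  have h1 : ∀ e : Fin m → Bool, Real.exp (l * (offCount e : ℝ))
      = ∏ t, if e t = false then Real.exp l else 1 := by
    intro e
    rw [Finset.prod_ite, Finset.prod_const, Finset.prod_const_one, mul_one, ← Real.exp_nat_mul,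
      mul_comm]
    rfl
  simp_rw [h1]
  rw [patternMean_prod ε fun t b => if b = false then Real.exp l else 1]
  simp only [Finset.prod_const, Finset.card_univ, Fintype.card_fin, Real.exp_nat_mul]
  simp only [reduceCtorEq, if_false, if_true, mul_one]
  refine pow_le_pow_left₀ (add_nonneg (by linarith [hε.2]) (mul_nonneg hε.1 (Real.exp_pos _).le)) ?_ _
  have h3 := exp_le_quadratic (x := l) (by rw [abs_of_nonneg hl0]; exact hl1)
  have h4 := Real.add_one_le_exp (ε * (l + l ^ 2))
  have h5 := mul_le_mul_of_nonneg_left h3 hε.1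
  linarith

/-! ### Consistent decoding of linear codes. -/

/-- With linear encoding `L`, channel state `s` and cache pattern `e`, some other value of the wanted
message is consistent with what the receiver sees. -/
def Confusable {n m₁ m₂ : ℕ} (L : Bits m₁ → Bits m₂ → Bits n) (s : Fin n → Bool)
    (e : Fin m₂ → Bool) : Prop :=
  ∃ d₁ d₂, d₁ ≠ 0 ∧ (∀ t, s t = true → L d₁ d₂ t = 0) ∧ (∀ l, e l = true → d₂ l = 0)

open Classical in
/-- The decoder that outputs some message consistent with what the receiver sees. -/
noncomputable def consistentDecoder {n m₁ m₂ : ℕ} (L : Bits m₁ → Bits m₂ → Bits n)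
    (y : Fin n → Option (ZMod 2)) (side : Fin m₂ → Option (ZMod 2)) : Bits m₁ :=
  if h : ∃ w : Bits m₁ × Bits m₂, ∃ s e, erase s (L w.1 w.2) = y ∧ erase e w.2 = side
  then h.choose.1 else 0

/-- The code with encoder `L` and consistent decoders. -/
noncomputable def consistentCode {n m₁ m₂ : ℕ} (L : Bits m₁ → Bits m₂ → Bits n) :
    BlindCode n m₁ m₂ where
  enc := L
  dec₁ := consistentDecoder L
  dec₂ := consistentDecoder fun w₂ w₁ => L w₁ w₂

theorem agree_of_erase_eq {n : ℕ} {s s' : Fin n → Bool} {x x' : Bits n}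
    (h : erase s' x' = erase s x) (t : Fin n) (ht : s t = true) : x' t = x t := by
  have := congrFun h t
  simp only [erase, ht, if_true] at this
  split_ifs at this
  exact Option.some.inj this

/-- By linearity, the difference between the decoder's candidate and the truth is invisible at the
received positions and zero on the cached bits. Only its first component has to vanish; the unwanted
message may remain ambiguous. -/
theorem consistentDecoder_eq {n m₁ m₂ : ℕ} {L : Bits m₁ → Bits m₂ → Bits n}
    (hL : ∀ v₁ v₂ w₁ w₂, L (v₁ - w₁) (v₂ - w₂) = L v₁ v₂ - L w₁ w₂)
    {s : Fin n → Bool} {e : Fin m₂ → Bool} (h : ¬Confusable L s e) (w₁ : Bits m₁) (w₂ : Bits m₂) :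
    consistentDecoder L (erase s (L w₁ w₂)) (erase e w₂) = w₁ := by
  have hex : ∃ w : Bits m₁ × Bits m₂, ∃ s' e', erase s' (L w.1 w.2) = erase s (L w₁ w₂) ∧
      erase e' w.2 = erase e w₂ := ⟨(w₁, w₂), s, e, rfl, rfl⟩
  rw [consistentDecoder, dif_pos hex]
  obtain ⟨s', e', hs, he⟩ := hex.choose_spec
  by_contra hne
  refine h ⟨hex.choose.1 - w₁, hex.choose.2 - w₂, sub_ne_zero.2 hne, fun t ht => ?_, fun l hl => ?_⟩
  · rw [hL, Pi.sub_apply, agree_of_erase_eq hs t ht, sub_self]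
  · rw [Pi.sub_apply, agree_of_erase_eq he l hl, sub_self]

theorem consistentCode_err₁_le {n m₁ m₂ : ℕ} {L : Bits m₁ → Bits m₂ → Bits n}
    (hL : ∀ v₁ v₂ w₁ w₂, L (v₁ - w₁) (v₂ - w₂) = L v₁ v₂ - L w₁ w₂) {δ₁ δ₂ ε₁ ε₂ : ℝ}
    (hδ₁ : 0 ≤ δ₁ ∧ δ₁ ≤ 1) (hε₁ : 0 ≤ ε₁ ∧ ε₁ ≤ 1) (hε₂ : 0 ≤ ε₂ ∧ ε₂ ≤ 1) :
    (consistentCode L).toNonBlind.err₁ δ₁ δ₂ ε₁ ε₂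
      ≤ patternMean δ₁ fun s => patternMean ε₁ fun e => ind (Confusable L s e) := by
  rw [NonBlindCode.err₁_eq]
  refine patternMean_mono hδ₁.1 hδ₁.2 fun s => patternMean_mono hε₁.1 hε₁.2 fun e => ?_
  refine le_trans (patternMean_mono hε₂.1 hε₂.2 fun e₂ => messageMean_mono
    (g := fun _ _ => ind (Confusable L s e)) fun w₁ w₂ => ?_) (le_of_eq ?_)
  · by_cases h : Confusable L s e
    · rw [ind_of h]; split_ifs <;> norm_num
    · rw [ind_of_not h]
      exact (if_pos (consistentDecoder_eq hL h w₁ w₂)).le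
  · simp_rw [messageMean_const, patternMean_const]

theorem consistentCode_err₂ {n m₁ m₂ : ℕ} (L : Bits m₁ → Bits m₂ → Bits n) (δ₁ δ₂ ε₁ ε₂ : ℝ) :
    (consistentCode L).toNonBlind.err₂ δ₁ δ₂ ε₁ ε₂
      = (consistentCode fun w₂ w₁ => L w₁ w₂).toNonBlind.err₁ δ₂ δ₁ ε₂ ε₁ :=
  ((consistentCode L).toNonBlind.err₁_swap δ₁ δ₂ ε₁ ε₂).symm

theorem card_vanishing_le {m : ℕ} (e : Fin m → Bool) :
    (Finset.univ.filter fun d : Bits m => ∀ l, e l = true → d l = 0).card ≤ 2 ^ offCount e := by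
  have h : onCount (fun l => !e l) = offCount e := by simp [onCount, offCount]
  rw [← h]
  refine le_trans (Finset.card_le_card_of_injOn (erase fun l => !e l)
    (fun d _ => Finset.mem_image_of_mem _ (Finset.mem_univ d)) ?_) (card_image_erase_le _)
  intro d hd d' hd' hdd
  simp only [Finset.coe_filter, Finset.mem_univ, true_and, Set.mem_ofPred_eq] at hd hd'
  funext l
  by_cases hl : e l = true
  · rw [hd l hl, hd' l hl]
  · exact (erase_eq_erase_iff _ _ _).1 hdd l (by simpa using hl)

/-- Either the combinations already annihilate `v`, with probability 2^(-k), or a nonzero vector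
enters the outer code and is annihilated at all positions in `T`. -/
theorem uniformMean_mulVec_mulVec_eq_zero_le {n k : ℕ} {ι : Type*} [Fintype ι] [DecidableEq ι]
    {v : ι → ZMod 2} (hv : v ≠ 0) (T : Finset (Fin n)) :
    uniformMean (fun A : Matrix (Fin k) ι (ZMod 2) => uniformMean
        fun G : Matrix (Fin n) (Fin k) (ZMod 2) => ind (∀ t ∈ T, G.mulVec (A.mulVec v) t = 0))
      ≤ (1 / 2 : ℝ) ^ k + (1 / 2 : ℝ) ^ T.card := by
  have h := uniformMean_mulVec_eq_zero hv (Finset.univ : Finset (Fin k))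
  rw [Finset.card_univ, Fintype.card_fin] at h
  rw [← h, ← uniformMean_const (α := Matrix (Fin k) ι (ZMod 2)) ((1 / 2 : ℝ) ^ T.card),
    ← uniformMean_add]
  refine uniformMean_mono fun A => ?_
  have hpow : (0 : ℝ) ≤ (1 / 2) ^ T.card := by positivity
  by_cases hA : A.mulVec v = 0
  · have hall : ∀ t ∈ (Finset.univ : Finset (Fin k)), A.mulVec v t = 0 := fun t _ => congrFun hA t
    rw [ind_of hall]
    have : uniformMean (fun G : Matrix (Fin n) (Fin k) (ZMod 2) =>
        ind (∀ t ∈ T, G.mulVec (A.mulVec v) t = 0)) ≤ 1 :=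
      (uniformMean_mono fun _ => ind_le_one _).trans (uniformMean_const 1).le
    linarith
  · rw [uniformMean_mulVec_eq_zero hA T]
    linarith [ind_nonneg (∀ t ∈ (Finset.univ : Finset (Fin k)), A.mulVec v t = 0)]

/-! ### The union bound for random two-stage linear codes. -/

section TwoStage

variable {n k m₁ m₂ : ℕ} {ι : Type*} [Fintype ι] [DecidableEq ι]

/-- Union bound over the possible differences. `J` stacks the two messages in either order, so one
estimate serves both receivers. -/
theorem uniformMean_confusable_le (J : Bits m₁ → Bits m₂ → ι → ZMod 2)
    (hJ : ∀ d₁ d₂, J d₁ d₂ = 0 → d₁ = 0) (s : Fin n → Bool) (e : Fin m₂ → Bool) :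
    uniformMean (fun A : Matrix (Fin k) ι (ZMod 2) => uniformMean
        fun G : Matrix (Fin n) (Fin k) (ZMod 2) =>
          ind (Confusable (fun d₁ d₂ => G.mulVec (A.mulVec (J d₁ d₂))) s e))
      ≤ 2 ^ (m₁ + offCount e) * (1 / 2 : ℝ) ^ k
        + 2 ^ (m₁ + offCount e) * (1 / 2 : ℝ) ^ onCount s := by
  set D : Finset (Bits m₁ × Bits m₂) := (Finset.univ.filter fun d₁ => d₁ ≠ 0) ×ˢ
    (Finset.univ.filter fun d : Bits m₂ => ∀ l, e l = true → d l = 0) with hD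
  set T : Finset (Fin n) := Finset.univ.filter fun t => s t = true with hT
  have hcard : D.card ≤ 2 ^ (m₁ + offCount e) := by
    rw [hD, Finset.card_product, pow_add]
    refine Nat.mul_le_mul ((Finset.card_le_univ _).trans ?_) (card_vanishing_le e)
    simp
  have h1 : ∀ (A : Matrix (Fin k) ι (ZMod 2)) (G : Matrix (Fin n) (Fin k) (ZMod 2)),
      ind (Confusable (fun d₁ d₂ => G.mulVec (A.mulVec (J d₁ d₂))) s e)
        ≤ ∑ d ∈ D, ind (∀ t ∈ T, G.mulVec (A.mulVec (J d.1 d.2)) t = 0) := by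
    intro A G
    refine le_trans (ind_mono ?_) (ind_exists_le _ _)
    rintro ⟨d₁, d₂, h0, hs, he⟩
    refine ⟨(d₁, d₂), ?_, fun t ht => hs t ?_⟩
    · simp [hD, h0]; exact he
    · simpa [hT] using ht
  refine (uniformMean_mono fun A => uniformMean_mono fun G => h1 A G).trans ?_
  simp_rw [uniformMean_sum]
  refine le_trans (Finset.sum_le_sum (g := fun _ => (1 / 2 : ℝ) ^ k + (1 / 2 : ℝ) ^ T.card)
    fun d hd => uniformMean_mulVec_mulVec_eq_zero_le ?_ T) ?_
  · intro h
    have : d.1 ≠ 0 := by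
      have := (Finset.mem_product.1 hd).1
      simpa using this
    exact this (hJ _ _ h)
  · rw [Finset.sum_const, nsmul_eq_mul, ← mul_add]
    refine mul_le_mul_of_nonneg_right ?_ (by positivity)
    exact_mod_cast hcard

theorem uniformMean_confusable_le_exp (J : Bits m₁ → Bits m₂ → ι → ZMod 2)
    (hJ : ∀ d₁ d₂, J d₁ d₂ = 0 → d₁ = 0) (s : Fin n → Bool) (e : Fin m₂ → Bool) {l : ℝ}
    (hl0 : 0 ≤ l) (hl1 : l ≤ Real.log 2) :
    uniformMean (fun A : Matrix (Fin k) ι (ZMod 2) => uniformMean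
        fun G : Matrix (Fin n) (Fin k) (ZMod 2) =>
          ind (Confusable (fun d₁ d₂ => G.mulVec (A.mulVec (J d₁ d₂))) s e))
      ≤ Real.exp (l * ((m₁ + offCount e : ℝ) - k))
        + Real.exp (l * ((m₁ + offCount e : ℝ) - onCount s)) := by
  set x := uniformMean (fun A : Matrix (Fin k) ι (ZMod 2) => uniformMean
        fun G : Matrix (Fin n) (Fin k) (ZMod 2) =>
          ind (Confusable (fun d₁ d₂ => G.mulVec (A.mulVec (J d₁ d₂))) s e))
  have hx := uniformMean_confusable_le (k := k) J hJ s e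
  have hx1 : x ≤ 1 := by
    refine (uniformMean_mono fun A => (uniformMean_mono fun G => ind_le_one _).trans
      (uniformMean_const 1).le).trans (uniformMean_const 1).le
  have ha := min_one_le_exp hl0 hl1 (min_le_left 1 _)
    (min_le_right 1 (2 ^ (m₁ + offCount e) * (1 / 2 : ℝ) ^ k))
    (u := (m₁ + offCount e : ℝ)) (v := k) (by push_cast; rfl) rfl
  have hb := min_one_le_exp hl0 hl1 (min_le_left 1 _)
    (min_le_right 1 (2 ^ (m₁ + offCount e) * (1 / 2 : ℝ) ^ onCount s))
    (u := (m₁ + offCount e : ℝ)) (v := onCount s) (by push_cast; rfl) rfl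
  refine le_trans ?_ (add_le_add ha hb)
  have p1 : (0 : ℝ) ≤ 2 ^ (m₁ + offCount e) * (1 / 2 : ℝ) ^ k := by positivity
  have p2 : (0 : ℝ) ≤ 2 ^ (m₁ + offCount e) * (1 / 2 : ℝ) ^ onCount s := by positivity
  rcases min_cases 1 (2 ^ (m₁ + offCount e) * (1 / 2 : ℝ) ^ k) with ⟨h, h'⟩ | ⟨h, h'⟩ <;>
  rcases min_cases 1 (2 ^ (m₁ + offCount e) * (1 / 2 : ℝ) ^ onCount s) with ⟨g, g'⟩ | ⟨g, g'⟩ <;>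
  rw [h, g] <;> linarith

/-- Averaging replaces the uncached and received counts by their means, at the price of terms of
order l². -/
theorem patternMean_uniformMean_confusable_le (J : Bits m₁ → Bits m₂ → ι → ZMod 2)
    (hJ : ∀ d₁ d₂, J d₁ d₂ = 0 → d₁ = 0) {l δ ε : ℝ} (hδ : 0 ≤ δ ∧ δ ≤ 1) (hε : 0 ≤ ε ∧ ε ≤ 1)
    (hl0 : 0 ≤ l) (hl1 : l ≤ Real.log 2) :
    uniformMean (fun A : Matrix (Fin k) ι (ZMod 2) => uniformMean
        fun G : Matrix (Fin n) (Fin k) (ZMod 2) => patternMean δ fun s => patternMean ε fun e =>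
          ind (Confusable (fun d₁ d₂ => G.mulVec (A.mulVec (J d₁ d₂))) s e))
      ≤ Real.exp (l * (m₁ + ε * m₂ - k) + l ^ 2 * (ε * m₂))
        + Real.exp (l * (m₁ + ε * m₂ - (1 - δ) * n) + l ^ 2 * (ε * m₂ + (1 - δ) * n)) := by
  have hl1' : l ≤ 1 := hl1.trans log_two_le_one
  simp_rw [uniformMean_patternMean]
  refine (patternMean_mono hδ.1 hδ.2 fun s => patternMean_mono hε.1 hε.2 fun e =>
    uniformMean_confusable_le_exp J hJ s e hl0 hl1).trans ?_
  have hsplit : ∀ (s : Fin n → Bool) (e : Fin m₂ → Bool),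
      Real.exp (l * ((m₁ + offCount e : ℝ) - k))
        + Real.exp (l * ((m₁ + offCount e : ℝ) - onCount s))
      = Real.exp (l * (m₁ - k)) * Real.exp (l * offCount e)
        + Real.exp (l * m₁) * Real.exp (l * offCount e) * Real.exp (-(l * onCount s)) := by
    intro s e
    rw [← Real.exp_add, ← Real.exp_add, ← Real.exp_add]
    congr 2 <;> ring
  simp_rw [hsplit, patternMean_add, patternMean_mul_const, patternMean_const_mul, patternMean_const]
  have h1 := patternMean_exp_le (m := m₂) hε hl0 hl1'
  have h2 := patternMean_exp_neg_le hδ hl0 hl1' (Finset.univ : Finset (Fin n))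
  rw [Finset.card_univ, Fintype.card_fin] at h2
  change patternMean δ (fun s => Real.exp (-(l * (onCount s : ℝ)))) ≤ _ at h2
  refine add_le_add ?_ ?_
  · refine (mul_le_mul_of_nonneg_left h1 (Real.exp_pos _).le).trans (le_of_eq ?_)
    rw [← Real.exp_add]
    congr 1; ring
  · refine (mul_le_mul (mul_le_mul_of_nonneg_left h1 (Real.exp_pos _).le) h2
      (patternMean_nonneg hδ.1 hδ.2 fun s => (Real.exp_pos _).le) (by positivity)).trans
      (le_of_eq ?_)
    rw [← Real.exp_add, ← Real.exp_add]
    congr 1; ring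

end TwoStage

/-! ### Errors of random-combination and time-sharing codes. -/

/-- The blind code that applies the matrix `A` to both messages and then the outer code `G`. -/
noncomputable def combinationCode {n k m₁ m₂ : ℕ} (G : Matrix (Fin n) (Fin k) (ZMod 2))
    (A : Matrix (Fin k) (Fin m₁ ⊕ Fin m₂) (ZMod 2)) : BlindCode n m₁ m₂ :=
  consistentCode fun w₁ w₂ => G.mulVec (A.mulVec (Sum.elim w₁ w₂))

theorem sum_elim_sub {m₁ m₂ : ℕ} (v₁ w₁ : Bits m₁) (v₂ w₂ : Bits m₂) :
    (Sum.elim (v₁ - w₁) (v₂ - w₂) : Fin m₁ ⊕ Fin m₂ → ZMod 2)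
      = Sum.elim v₁ v₂ - Sum.elim w₁ w₂ := by
  funext i
  cases i <;> simp

theorem uniformMean_err₁_combinationCode_le {n k m₁ m₂ : ℕ} {δ₁ δ₂ ε₁ ε₂ l : ℝ}
    (hδ₁ : 0 ≤ δ₁ ∧ δ₁ ≤ 1) (hε₁ : 0 ≤ ε₁ ∧ ε₁ ≤ 1) (hε₂ : 0 ≤ ε₂ ∧ ε₂ ≤ 1)
    (hl0 : 0 ≤ l) (hl1 : l ≤ Real.log 2) :
    uniformMean (fun A : Matrix (Fin k) (Fin m₁ ⊕ Fin m₂) (ZMod 2) => uniformMean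
        fun G : Matrix (Fin n) (Fin k) (ZMod 2) =>
          (combinationCode G A).toNonBlind.err₁ δ₁ δ₂ ε₁ ε₂)
      ≤ Real.exp (l * (m₁ + ε₁ * m₂ - k) + l ^ 2 * (ε₁ * m₂))
        + Real.exp (l * (m₁ + ε₁ * m₂ - (1 - δ₁) * n) + l ^ 2 * (ε₁ * m₂ + (1 - δ₁) * n)) := by
  refine (uniformMean_mono fun A => uniformMean_mono fun G =>
    consistentCode_err₁_le ?_ hδ₁ hε₁ hε₂).trans
    (patternMean_uniformMean_confusable_le (fun w₁ w₂ => Sum.elim w₁ w₂) ?_ hδ₁ hε₁ hl0 hl1)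
  · intro v₁ v₂ w₁ w₂
    rw [sum_elim_sub, Matrix.mulVec_sub, Matrix.mulVec_sub]
  · intro d₁ d₂ h
    funext i
    exact congrFun h (Sum.inl i)

theorem uniformMean_err₂_combinationCode_le {n k m₁ m₂ : ℕ} {δ₁ δ₂ ε₁ ε₂ l : ℝ}
    (hδ₂ : 0 ≤ δ₂ ∧ δ₂ ≤ 1) (hε₁ : 0 ≤ ε₁ ∧ ε₁ ≤ 1) (hε₂ : 0 ≤ ε₂ ∧ ε₂ ≤ 1)
    (hl0 : 0 ≤ l) (hl1 : l ≤ Real.log 2) :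
    uniformMean (fun A : Matrix (Fin k) (Fin m₁ ⊕ Fin m₂) (ZMod 2) => uniformMean
        fun G : Matrix (Fin n) (Fin k) (ZMod 2) =>
          (combinationCode G A).toNonBlind.err₂ δ₁ δ₂ ε₁ ε₂)
      ≤ Real.exp (l * (m₂ + ε₂ * m₁ - k) + l ^ 2 * (ε₂ * m₁))
        + Real.exp (l * (m₂ + ε₂ * m₁ - (1 - δ₂) * n) + l ^ 2 * (ε₂ * m₁ + (1 - δ₂) * n)) := by
  simp_rw [combinationCode, consistentCode_err₂]
  refine (uniformMean_mono fun A => uniformMean_mono fun G =>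
    consistentCode_err₁_le ?_ hδ₂ hε₂ hε₁).trans
    (patternMean_uniformMean_confusable_le (fun w₂ w₁ => Sum.elim w₁ w₂) ?_ hδ₂ hε₂ hl0 hl1)
  · intro v₁ v₂ w₁ w₂
    rw [sum_elim_sub, Matrix.mulVec_sub, Matrix.mulVec_sub]
  · intro d₁ d₂ h
    funext i
    exact congrFun h (Sum.inr i)

/-- At the positions in `I` message 1 is sent without interference, and the received ones among them
suffice for the union bound; the cache and all other positions are ignored. -/
theorem uniformMean_err₁_le_of_dedicated {n m₁ m₂ : ℕ} {δ₁ δ₂ ε₁ ε₂ l : ℝ}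
    (hδ₁ : 0 ≤ δ₁ ∧ δ₁ ≤ 1) (hε₁ : 0 ≤ ε₁ ∧ ε₁ ≤ 1) (hε₂ : 0 ≤ ε₂ ∧ ε₂ ≤ 1)
    (hl0 : 0 ≤ l) (hl1 : l ≤ Real.log 2) (I : Finset (Fin n))
    (L : Matrix (Fin n) (Fin m₁) (ZMod 2) → Bits m₁ → Bits m₂ → Bits n)
    (hL : ∀ G v₁ v₂ w₁ w₂, L G (v₁ - w₁) (v₂ - w₂) = L G v₁ v₂ - L G w₁ w₂)
    (hI : ∀ G, ∀ t ∈ I, ∀ d₁ d₂, L G d₁ d₂ t = G.mulVec d₁ t) :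
    uniformMean (fun G => (consistentCode (L G)).toNonBlind.err₁ δ₁ δ₂ ε₁ ε₂)
      ≤ Real.exp (l * (m₁ - (1 - δ₁) * I.card) + l ^ 2 * ((1 - δ₁) * I.card)) := by
  have hl1' : l ≤ 1 := hl1.trans log_two_le_one
  refine (uniformMean_mono fun G => consistentCode_err₁_le (hL G) hδ₁ hε₁ hε₂).trans ?_
  simp_rw [uniformMean_patternMean]
  have h1 : ∀ (s : Fin n → Bool) (e : Fin m₂ → Bool),
      uniformMean (fun G => ind (Confusable (L G) s e))
        ≤ Real.exp (l * (m₁ - ((I.filter fun t => s t = true).card : ℝ))) := by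
    intro s e
    set T := I.filter fun t => s t = true with hT
    refine min_one_le_exp (a := m₁) (b := T.card) hl0 hl1
      ((uniformMean_mono fun G => ind_le_one _).trans (uniformMean_const 1).le) ?_ rfl rfl
    set D : Finset (Bits m₁) := Finset.univ.filter fun d => d ≠ 0 with hD
    have h2 : ∀ G, ind (Confusable (L G) s e)
        ≤ ∑ d ∈ D, ind (∀ t ∈ T, G.mulVec d t = 0) := by
      intro G
      refine le_trans (ind_mono ?_) (ind_exists_le _ _)
      rintro ⟨d₁, d₂, h0, hs, -⟩
      refine ⟨d₁, by simp [hD, h0], fun t ht => ?_⟩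
      rw [hT, Finset.mem_filter] at ht
      rw [← hI G t ht.1 d₁ d₂]
      exact hs t ht.2
    refine (uniformMean_mono h2).trans ?_
    rw [uniformMean_sum]
    refine le_trans (Finset.sum_le_sum (g := fun _ => (1 / 2 : ℝ) ^ T.card)
      fun d hd => (uniformMean_mulVec_eq_zero (by simpa [hD] using hd) T).le) ?_
    rw [Finset.sum_const, nsmul_eq_mul]
    refine mul_le_mul_of_nonneg_right ?_ (by positivity)
    have : D.card ≤ 2 ^ m₁ := (Finset.card_le_univ _).trans (by simp)
    exact_mod_cast this
  refine (patternMean_mono hδ₁.1 hδ₁.2 fun s => (patternMean_mono hε₁.1 hε₁.2 fun e =>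
    h1 s e).trans (patternMean_const _ _).le).trans ?_
  have hsplit : ∀ s : Fin n → Bool,
      Real.exp (l * (m₁ - ((I.filter fun t => s t = true).card : ℝ)))
      = Real.exp (l * m₁) * Real.exp (-(l * ((I.filter fun t => s t = true).card : ℝ))) := by
    intro s
    rw [← Real.exp_add]
    congr 1; ring
  simp_rw [hsplit, patternMean_const_mul]
  refine (mul_le_mul_of_nonneg_left (patternMean_exp_neg_le hδ₁ hl0 hl1' I)
    (Real.exp_pos _).le).trans (le_of_eq ?_)
  rw [← Real.exp_add]
  congr 1; ring

/-- The time-sharing encoder: message 1 is sent at the positions in `I`, message 2 elsewhere. -/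
def timeSharing {n m₁ m₂ : ℕ} (I : Finset (Fin n)) (G₁ : Matrix (Fin n) (Fin m₁) (ZMod 2))
    (G₂ : Matrix (Fin n) (Fin m₂) (ZMod 2)) (w₁ : Bits m₁) (w₂ : Bits m₂) : Bits n :=
  fun t => if t ∈ I then G₁.mulVec w₁ t else G₂.mulVec w₂ t

theorem exists_timeSharing_code {n m₁ m₂ : ℕ} {δ₁ δ₂ ε₁ ε₂ l : ℝ}
    (hδ₁ : 0 ≤ δ₁ ∧ δ₁ ≤ 1) (hδ₂ : 0 ≤ δ₂ ∧ δ₂ ≤ 1) (hε₁ : 0 ≤ ε₁ ∧ ε₁ ≤ 1)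
    (hε₂ : 0 ≤ ε₂ ∧ ε₂ ≤ 1) (hl0 : 0 ≤ l) (hl1 : l ≤ Real.log 2) (I : Finset (Fin n)) :
    ∃ c : BlindCode n m₁ m₂,
      c.toNonBlind.err₁ δ₁ δ₂ ε₁ ε₂ + c.toNonBlind.err₂ δ₁ δ₂ ε₁ ε₂
        ≤ Real.exp (l * (m₁ - (1 - δ₁) * I.card) + l ^ 2 * ((1 - δ₁) * I.card))
          + Real.exp (l * (m₂ - (1 - δ₂) * Iᶜ.card) + l ^ 2 * ((1 - δ₂) * Iᶜ.card)) := by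
  have hsub : ∀ (G₁ : Matrix (Fin n) (Fin m₁) (ZMod 2)) (G₂ : Matrix (Fin n) (Fin m₂) (ZMod 2))
      v₁ v₂ w₁ w₂, timeSharing I G₁ G₂ (v₁ - w₁) (v₂ - w₂)
        = timeSharing I G₁ G₂ v₁ v₂ - timeSharing I G₁ G₂ w₁ w₂ := by
    intro G₁ G₂ v₁ v₂ w₁ w₂
    funext t
    simp only [timeSharing, Matrix.mulVec_sub, Pi.sub_apply]
    split_ifs <;> rfl
  -- The other phase's matrix is arbitrary here, so the bound survives averaging over it.
  have h1 : ∀ G₂ : Matrix (Fin n) (Fin m₂) (ZMod 2), _ := fun G₂ =>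
    uniformMean_err₁_le_of_dedicated (δ₂ := δ₂) hδ₁ hε₁ hε₂ hl0 hl1 I
      (fun G₁ : Matrix (Fin n) (Fin m₁) (ZMod 2) => timeSharing I G₁ G₂)
      (fun G₁ => hsub G₁ G₂) (fun G₁ t ht d₁ d₂ => if_pos ht)
  have h2 : ∀ G₁ : Matrix (Fin n) (Fin m₁) (ZMod 2), _ := fun G₁ =>
    uniformMean_err₁_le_of_dedicated (δ₂ := δ₁) hδ₂ hε₂ hε₁ hl0 hl1 Iᶜ
      (fun (G₂ : Matrix (Fin n) (Fin m₂) (ZMod 2)) w₂ w₁ => timeSharing I G₁ G₂ w₁ w₂)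
      (fun G₂ v₂ v₁ w₂ w₁ => hsub G₁ G₂ v₁ v₂ w₁ w₂)
      (fun G₂ t ht d₂ d₁ => if_neg (Finset.mem_compl.1 ht))
  have h3 := (uniformMean_mono h1).trans (uniformMean_const _).le
  have h4 := (uniformMean_mono h2).trans (uniformMean_const _).le
  rw [uniformMean_comm] at h3
  obtain ⟨G₁, hG₁⟩ := exists_le_of_uniformMean_le
    ((uniformMean_add _ _).le.trans (add_le_add h3 h4))
  obtain ⟨G₂, hG₂⟩ := exists_le_of_uniformMean_le ((uniformMean_add _ _).le.trans hG₁)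
  refine ⟨consistentCode (timeSharing I G₁ G₂), ?_⟩
  rw [consistentCode_err₂]
  exact hG₂

/-- Only the outer matrix is fixed; `A` stays random, as the corner-point claim requires. Bounding
the sum of the two errors lets one `G` serve both receivers. -/
theorem exists_outer_code {n k m₁ m₂ : ℕ} {δ₁ δ₂ ε₁ ε₂ l : ℝ}
    (hδ₁ : 0 ≤ δ₁ ∧ δ₁ ≤ 1) (hδ₂ : 0 ≤ δ₂ ∧ δ₂ ≤ 1) (hε₁ : 0 ≤ ε₁ ∧ ε₁ ≤ 1)
    (hε₂ : 0 ≤ ε₂ ∧ ε₂ ≤ 1) (hl0 : 0 ≤ l) (hl1 : l ≤ Real.log 2) :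
    ∃ G : Matrix (Fin n) (Fin k) (ZMod 2),
      uniformMean (fun A : Matrix (Fin k) (Fin m₁ ⊕ Fin m₂) (ZMod 2) =>
          (combinationCode G A).toNonBlind.err₁ δ₁ δ₂ ε₁ ε₂)
        + uniformMean (fun A : Matrix (Fin k) (Fin m₁ ⊕ Fin m₂) (ZMod 2) =>
          (combinationCode G A).toNonBlind.err₂ δ₁ δ₂ ε₁ ε₂)
      ≤ (Real.exp (l * (m₁ + ε₁ * m₂ - k) + l ^ 2 * (ε₁ * m₂))
        + Real.exp (l * (m₁ + ε₁ * m₂ - (1 - δ₁) * n) + l ^ 2 * (ε₁ * m₂ + (1 - δ₁) * n)))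
        + (Real.exp (l * (m₂ + ε₂ * m₁ - k) + l ^ 2 * (ε₂ * m₁))
        + Real.exp (l * (m₂ + ε₂ * m₁ - (1 - δ₂) * n) + l ^ 2 * (ε₂ * m₁ + (1 - δ₂) * n))) := by
  have h1 := uniformMean_err₁_combinationCode_le (n := n) (k := k) (m₁ := m₁) (m₂ := m₂)
    (δ₂ := δ₂) hδ₁ hε₁ hε₂ hl0 hl1
  have h2 := uniformMean_err₂_combinationCode_le (n := n) (k := k) (m₁ := m₁) (m₂ := m₂)
    (δ₁ := δ₁) hδ₂ hε₁ hε₂ hl0 hl1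
  rw [uniformMean_comm] at h1 h2
  exact exists_le_of_uniformMean_le ((uniformMean_add _ _).le.trans (add_le_add h1 h2))

/-! ### Asymptotics with tilt n^(-1/3). -/

/-- The cube root of the block length. -/
noncomputable def cbrt (n : ℕ) : ℝ := (n : ℝ) ^ (1 / 3 : ℝ)

theorem cbrt_nonneg (n : ℕ) : 0 ≤ cbrt n := Real.rpow_nonneg (Nat.cast_nonneg n) _

theorem cbrt_pow_three (n : ℕ) : cbrt n ^ 3 = n := by
  rw [cbrt, ← Real.rpow_natCast, ← Real.rpow_mul (Nat.cast_nonneg n)]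
  norm_num

theorem tendsto_cbrt : Tendsto cbrt atTop atTop :=
  (tendsto_rpow_atTop (by norm_num)).comp tendsto_natCast_atTop_atTop

/-- With tilt n^(-1/3), a deficit of 4n^(2/3) contributes -4n^(1/3), which beats the second-order
term of at most 2n^(1/3). -/
theorem tendsto_exp_quadratic {a b : ℕ → ℝ} (ha : ∀ᶠ n in atTop, a n ≤ -4 * cbrt n ^ 2)
    (hb : ∀ᶠ n in atTop, b n ≤ 2 * (n : ℝ)) :
    Tendsto (fun n => Real.exp ((cbrt n)⁻¹ * a n + (cbrt n)⁻¹ ^ 2 * b n)) atTop (𝓝 0) := by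
  have hlim : Tendsto (fun n => -2 * cbrt n) atTop atBot :=
    tendsto_cbrt.const_mul_atTop_of_neg (by norm_num)
  refine Real.tendsto_exp_atBot.comp (tendsto_atBot_mono' _ ?_ hlim)
  filter_upwards [ha, hb, tendsto_cbrt.eventually_gt_atTop 0] with n ha hb hx
  rw [← cbrt_pow_three] at hb
  have hi : 0 < (cbrt n)⁻¹ := inv_pos.2 hx
  have h1 := mul_le_mul_of_nonneg_left ha hi.le
  have h2 := mul_le_mul_of_nonneg_left hb (pow_pos hi 2).le
  have h3 : (cbrt n)⁻¹ * (-4 * cbrt n ^ 2) = -4 * cbrt n := by field_simp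
  have h4 : (cbrt n)⁻¹ ^ 2 * (2 * cbrt n ^ 3) = 2 * cbrt n := by field_simp
  linarith

theorem tendsto_add_zero {f g : ℕ → ℝ} (hf : Tendsto f atTop (𝓝 0)) (hg : Tendsto g atTop (𝓝 0)) :
    Tendsto (fun n => f n + g n) atTop (𝓝 0) := by
  have := hf.add hg
  rwa [add_zero] at this

theorem eventually_linear_slack {c C : ℝ} (hc : 0 < c) :
    ∀ᶠ n : ℕ in atTop, -c * n + C ≤ -4 * cbrt n ^ 2 := by
  filter_upwards [tendsto_cbrt.eventually_ge_atTop 1,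
    tendsto_cbrt.eventually_ge_atTop ((4 + |C|) / c)] with n h1 h2
  rw [div_le_iff₀ hc] at h2
  rw [← cbrt_pow_three]
  have h3 : (4 + |C|) * cbrt n ^ 2 ≤ cbrt n * c * cbrt n ^ 2 :=
    mul_le_mul_of_nonneg_right h2 (by positivity)
  have h4 : |C| * 1 ≤ |C| * cbrt n ^ 2 := mul_le_mul_of_nonneg_left (one_le_pow₀ h1) (abs_nonneg C)
  have h5 := le_abs_self C
  nlinarith

theorem eventually_inv_cbrt_le : ∀ᶠ n in atTop, (cbrt n)⁻¹ ≤ Real.log 2 :=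
  (tendsto_inv_atTop_zero.comp tendsto_cbrt).eventually_le_const
    (Real.log_pos (by norm_num))

/-! ### Achievable rate pairs and the inner bound. -/

theorem ceil_mul_le {n : ℕ} {R : ℝ} (hR : 0 ≤ R) : (⌈(n : ℝ) * R⌉₊ : ℝ) ≤ n * R + 1 :=
  (Nat.ceil_lt_add_one (by positivity)).le

theorem ceil_mul_le_self {n : ℕ} {R : ℝ} (hR : R ≤ 1) : (⌈(n : ℝ) * R⌉₊ : ℝ) ≤ n := by
  have : ⌈(n : ℝ) * R⌉₊ ≤ n := Nat.ceil_le.2 (mul_le_of_le_one_right (Nat.cast_nonneg n) hR)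
  exact_mod_cast this

/-- Errors are nonnegative, so a bound on their sum controls both. Block lengths without a good code
receive an arbitrary one, which does not affect the limit. -/
theorem blindAchievable_of_le {δ₁ δ₂ ε₁ ε₂ : ℝ} {R : ℝ × ℝ}
    (hδ₁ : 0 ≤ δ₁ ∧ δ₁ ≤ 1) (hδ₂ : 0 ≤ δ₂ ∧ δ₂ ≤ 1) (hε₁ : 0 ≤ ε₁ ∧ ε₁ ≤ 1)
    (hε₂ : 0 ≤ ε₂ ∧ ε₂ ≤ 1) (h1 : 0 ≤ R.1) (h2 : 0 ≤ R.2) {B : ℕ → ℝ}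
    (hB : Tendsto B atTop (𝓝 0))
    (h : ∀ᶠ n : ℕ in atTop, ∃ c : BlindCode n ⌈(n : ℝ) * R.1⌉₊ ⌈(n : ℝ) * R.2⌉₊,
      c.toNonBlind.err₁ δ₁ δ₂ ε₁ ε₂ + c.toNonBlind.err₂ δ₁ δ₂ ε₁ ε₂ ≤ B n) :
    BlindAchievable δ₁ δ₂ ε₁ ε₂ R := by
  have hex : ∀ n : ℕ, ∃ c : BlindCode n ⌈(n : ℝ) * R.1⌉₊ ⌈(n : ℝ) * R.2⌉₊,
      (∃ c' : BlindCode n ⌈(n : ℝ) * R.1⌉₊ ⌈(n : ℝ) * R.2⌉₊,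
        c'.toNonBlind.err₁ δ₁ δ₂ ε₁ ε₂ + c'.toNonBlind.err₂ δ₁ δ₂ ε₁ ε₂ ≤ B n) →
      c.toNonBlind.err₁ δ₁ δ₂ ε₁ ε₂ + c.toNonBlind.err₂ δ₁ δ₂ ε₁ ε₂ ≤ B n := by
    intro n
    by_cases hn : ∃ c' : BlindCode n ⌈(n : ℝ) * R.1⌉₊ ⌈(n : ℝ) * R.2⌉₊,
        c'.toNonBlind.err₁ δ₁ δ₂ ε₁ ε₂ + c'.toNonBlind.err₂ δ₁ δ₂ ε₁ ε₂ ≤ B n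
    · exact ⟨hn.choose, fun _ => hn.choose_spec⟩
    · exact ⟨consistentCode fun _ _ => 0, fun h' => absurd h' hn⟩
  choose c hc using hex
  have n1 := fun n => (c n).toNonBlind.err₁_nonneg (δ₂ := δ₂) hδ₁ hε₁ hε₂
  have n2 := fun n => (c n).toNonBlind.err₂_nonneg (δ₁ := δ₁) hδ₂ hε₁ hε₂
  refine ⟨h1, h2, c, ?_, ?_⟩
  · refine tendsto_of_tendsto_of_tendsto_of_le_of_le' tendsto_const_nhds hB
      (Eventually.of_forall n1) ?_
    filter_upwards [h] with n hn
    linarith [hc n hn, n2 n]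
  · refine tendsto_of_tendsto_of_tendsto_of_le_of_le' tendsto_const_nhds hB
      (Eventually.of_forall n2) ?_
    filter_upwards [h] with n hn
    linarith [hc n hn, n1 n]

/-- Rate pairs for which both receivers can decode both messages from random linear combinations. -/
theorem blindAchievable_of_lt {δ₁ δ₂ ε₁ ε₂ : ℝ} {R : ℝ × ℝ}
    (hδ₁ : 0 ≤ δ₁ ∧ δ₁ ≤ 1) (hδ₂ : 0 ≤ δ₂ ∧ δ₂ ≤ 1) (hε₁ : 0 ≤ ε₁ ∧ ε₁ ≤ 1)
    (hε₂ : 0 ≤ ε₂ ∧ ε₂ ≤ 1) (h1 : 0 ≤ R.1) (h2 : 0 ≤ R.2)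
    (hR₁ : R.1 + ε₁ * R.2 < 1 - δ₁) (hR₂ : R.2 + ε₂ * R.1 < 1 - δ₂) :
    BlindAchievable δ₁ δ₂ ε₁ ε₂ R := by
  have key : ∀ {δ ε x y : ℝ}, 0 ≤ δ ∧ δ ≤ 1 → 0 ≤ ε ∧ ε ≤ 1 → 0 ≤ x → 0 ≤ y → y ≤ 1 →
      x + ε * y < 1 - δ → Tendsto (fun n : ℕ =>
        Real.exp ((cbrt n)⁻¹ * (⌈(n : ℝ) * x⌉₊ + ε * ⌈(n : ℝ) * y⌉₊ - n)
          + (cbrt n)⁻¹ ^ 2 * (ε * ⌈(n : ℝ) * y⌉₊))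
        + Real.exp ((cbrt n)⁻¹ * (⌈(n : ℝ) * x⌉₊ + ε * ⌈(n : ℝ) * y⌉₊ - (1 - δ) * n)
          + (cbrt n)⁻¹ ^ 2 * (ε * ⌈(n : ℝ) * y⌉₊ + (1 - δ) * n))) atTop (𝓝 0) := by
    intro δ ε x y hδ hε hx hy hy1 hlt
    -- The constant 2 absorbs the two ceilings, which cost 1 + ε.
    have hs := eventually_linear_slack (c := 1 - δ - (x + ε * y)) (C := 2) (by linarith)
    have hm : ∀ n : ℕ, (⌈(n : ℝ) * x⌉₊ + ε * ⌈(n : ℝ) * y⌉₊ : ℝ) ≤ (x + ε * y) * n + 2 := by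
      intro n
      have e1 := ceil_mul_le (n := n) hx
      have e2 := mul_le_mul_of_nonneg_left (ceil_mul_le (n := n) hy) hε.1
      linarith [hε.2]
    have hq : ∀ n : ℕ, ε * (⌈(n : ℝ) * y⌉₊ : ℝ) ≤ n := fun n =>
      (mul_le_of_le_one_left (Nat.cast_nonneg _) hε.2).trans (ceil_mul_le_self hy1)
    have hd : ∀ n : ℕ, (1 - δ) * (n : ℝ) ≤ n := fun n =>
      mul_le_of_le_one_left (Nat.cast_nonneg _) (by linarith [hδ.1])
    have t1 := tendsto_exp_quadratic (a := fun n : ℕ => ⌈(n : ℝ) * x⌉₊ + ε * ⌈(n : ℝ) * y⌉₊ - n)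
      (b := fun n : ℕ => ε * ⌈(n : ℝ) * y⌉₊)
      (by filter_upwards [hs] with n hn; linarith [hm n, hd n])
      (Eventually.of_forall fun n => by
        have : (0 : ℝ) ≤ n := Nat.cast_nonneg n
        linarith [hq n])
    have t2 := tendsto_exp_quadratic
      (a := fun n : ℕ => ⌈(n : ℝ) * x⌉₊ + ε * ⌈(n : ℝ) * y⌉₊ - (1 - δ) * n)
      (b := fun n : ℕ => ε * ⌈(n : ℝ) * y⌉₊ + (1 - δ) * n)
      (by filter_upwards [hs] with n hn; linarith [hm n])
      (Eventually.of_forall fun n => by linarith [hq n, hd n])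
    exact tendsto_add_zero t1 t2
  have p1 := mul_nonneg hε₁.1 h2
  have p2 := mul_nonneg hε₂.1 h1
  refine blindAchievable_of_le hδ₁ hδ₂ hε₁ hε₂ h1 h2
    (tendsto_add_zero (key hδ₁ hε₁ h1 h2 (by linarith [hδ₂.1]) hR₁)
      (key hδ₂ hε₂ h2 h1 (by linarith [hδ₁.1]) hR₂)) ?_
  filter_upwards [eventually_inv_cbrt_le] with n hn
  obtain ⟨G, hG⟩ := exists_outer_code (n := n) (k := n) (m₁ := ⌈(n : ℝ) * R.1⌉₊)
    (m₂ := ⌈(n : ℝ) * R.2⌉₊) hδ₁ hδ₂ hε₁ hε₂ (inv_nonneg.2 (cbrt_nonneg n)) hn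
  obtain ⟨A, hA⟩ := exists_le_of_uniformMean_le ((uniformMean_add _ _).le.trans hG)
  exact ⟨combinationCode G A, hA⟩

theorem blindAchievable_of_timeSharing {δ₁ δ₂ ε₁ ε₂ : ℝ} {R : ℝ × ℝ}
    (hδ₁ : 0 ≤ δ₁ ∧ δ₁ < 1) (hδ₂ : 0 ≤ δ₂ ∧ δ₂ < 1) (hε₁ : 0 ≤ ε₁ ∧ ε₁ ≤ 1)
    (hε₂ : 0 ≤ ε₂ ∧ ε₂ ≤ 1) (h1 : 0 ≤ R.1) (h2 : 0 ≤ R.2)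
    (hR : R.1 / (1 - δ₁) + R.2 / (1 - δ₂) < 1) :
    BlindAchievable δ₁ δ₂ ε₁ ε₂ R := by
  have hp₁ : 0 < 1 - δ₁ := by linarith [hδ₁.2]
  have hp₂ : 0 < 1 - δ₂ := by linarith [hδ₂.2]
  -- Half of the unused time fraction: each phase exceeds its required share of the block by η.
  set η : ℝ := (1 - (R.1 / (1 - δ₁) + R.2 / (1 - δ₂))) / 2 with hη
  have hη0 : 0 < η := by rw [hη]; linarith
  set θ : ℝ := R.1 / (1 - δ₁) + η with hθ
  have q1 : 0 ≤ R.1 / (1 - δ₁) := div_nonneg h1 hp₁.le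
  have q2 : 0 ≤ R.2 / (1 - δ₂) := div_nonneg h2 hp₂.le
  have hθ0 : 0 ≤ θ := by linarith
  have hθ1 : θ ≤ 1 := by linarith
  have r1 : R.1 = (1 - δ₁) * (θ - η) := by rw [hθ]; field_simp; ring
  have r2 : R.2 = (1 - δ₂) * (1 - θ - η) := by rw [hθ, hη]; field_simp; ring
  let I : (n : ℕ) → Finset (Fin n) := fun n => Finset.univ.filter fun t => (t : ℕ) < ⌊θ * n⌋₊
  have hfl : ∀ n : ℕ, ⌊θ * n⌋₊ ≤ n := fun n => Nat.floor_le_of_le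
    (mul_le_of_le_one_left (Nat.cast_nonneg n) hθ1)
  have hI : ∀ n, (I n).card = ⌊θ * n⌋₊ := by
    intro n
    have := Fin.card_filter_val_lt (n := n) (m := ⌊θ * n⌋₊)
    rw [min_eq_right (hfl n)] at this
    exact this
  have hIc : ∀ n, ((I n)ᶜ.card : ℝ) = n - (I n).card := by
    intro n
    rw [Finset.card_compl, Fintype.card_fin, Nat.cast_sub (by rw [hI]; exact hfl n)]
  have g1 : ∀ n, θ * n - 1 ≤ ((I n).card : ℝ) := fun n => by
    rw [hI]; exact (Nat.sub_one_lt_floor _).le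
  have g2 : ∀ n, ((I n).card : ℝ) ≤ θ * n := fun n => by
    rw [hI]; exact Nat.floor_le (by positivity)
  have t1 := tendsto_exp_quadratic
    (a := fun n : ℕ => ⌈(n : ℝ) * R.1⌉₊ - (1 - δ₁) * (I n).card)
    (b := fun n : ℕ => (1 - δ₁) * (I n).card)
    (by
      filter_upwards [eventually_linear_slack (c := (1 - δ₁) * η) (C := 2) (by positivity)] with n hn
      have e1 := ceil_mul_le (n := n) h1
      have e2 := mul_le_mul_of_nonneg_left (g1 n) hp₁.le
      have e3 : (n : ℝ) * R.1 = n * ((1 - δ₁) * (θ - η)) := by rw [← r1]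
      linarith [hδ₁.1])
    (Eventually.of_forall fun n => by
      have e1 : (1 - δ₁) * ((I n).card : ℝ) ≤ 1 * (I n).card :=
        mul_le_mul_of_nonneg_right (by linarith [hδ₁.1]) (Nat.cast_nonneg _)
      have e2 : θ * n ≤ 1 * (n : ℝ) := mul_le_mul_of_nonneg_right hθ1 (Nat.cast_nonneg _)
      have e3 : (0 : ℝ) ≤ n := Nat.cast_nonneg n
      linarith [g2 n])
  have t2 := tendsto_exp_quadratic
    (a := fun n : ℕ => ⌈(n : ℝ) * R.2⌉₊ - (1 - δ₂) * (I n)ᶜ.card)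
    (b := fun n : ℕ => (1 - δ₂) * (I n)ᶜ.card)
    (by
      filter_upwards [eventually_linear_slack (c := (1 - δ₂) * η) (C := 2) (by positivity)] with n hn
      have e1 := ceil_mul_le (n := n) h2
      have e2 := mul_le_mul_of_nonneg_left (g2 n) hp₂.le
      have e3 : (n : ℝ) * R.2 = n * ((1 - δ₂) * (1 - θ - η)) := by rw [← r2]
      rw [hIc]
      linarith [hδ₂.1])
    (Eventually.of_forall fun n => by
      have e1 : (1 - δ₂) * ((I n)ᶜ.card : ℝ) ≤ 1 * (I n)ᶜ.card :=
        mul_le_mul_of_nonneg_right (by linarith [hδ₂.1]) (Nat.cast_nonneg _)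
      have e2 := hIc n
      have e3 : (0 : ℝ) ≤ (I n).card := Nat.cast_nonneg _
      have e4 : (0 : ℝ) ≤ n := Nat.cast_nonneg n
      linarith)
  refine blindAchievable_of_le ⟨hδ₁.1, hδ₁.2.le⟩ ⟨hδ₂.1, hδ₂.2.le⟩ hε₁ hε₂ h1 h2
    (tendsto_add_zero t1 t2) ?_
  filter_upwards [eventually_inv_cbrt_le] with n hn
  exact exists_timeSharing_code ⟨hδ₁.1, hδ₁.2.le⟩ ⟨hδ₂.1, hδ₂.2.le⟩ hε₁ hε₂
    (inv_nonneg.2 (cbrt_nonneg n)) hn (I n)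

/-- Multiples by τ < 1 satisfy the constraints strictly and converge to the given point. For ε₂ = 1
the first constraint is the time-sharing line; otherwise the constraints are those of random linear
combinations. -/
theorem rateRegion_subset_blindCapacity {δ₁ δ₂ ε₁ ε₂ : ℝ}
    (hδ₁ : 0 ≤ δ₁ ∧ δ₁ < 1) (hδ₂ : 0 ≤ δ₂ ∧ δ₂ < 1)
    (hε₁ : 0 ≤ ε₁ ∧ ε₁ ≤ 1) (hε₂ : 0 ≤ ε₂ ∧ ε₂ ≤ 1)
    (h : (δ₁ ≤ δ₂ ∧ (ε₂ = 0 ∨ ε₂ = 1)) ∨ (δ₁ = δ₂ ∧ ε₁ = ε₂)) :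
    rateRegion δ₁ δ₂ ε₁ ε₂ ⊆ blindCapacity δ₁ δ₂ ε₁ ε₂ := by
  rintro R ⟨h1, h2, hR₁, hR₂⟩
  have hp₁ : 0 < 1 - δ₁ := by linarith [hδ₁.2]
  have hp₂ : 0 < 1 - δ₂ := by linarith [hδ₂.2]
  have hle : δ₁ ≤ δ₂ := by
    rcases h with h | h
    · exact h.1
    · exact h.1.le
  rw [min_eq_right ((one_le_div hp₂).2 (by linarith)), mul_one] at hR₂
  rw [min_eq_left ((div_le_one hp₁).2 (by linarith))] at hR₁
  have scale : ∀ {x y τ : ℝ}, 0 < y → 0 ≤ τ → τ < 1 → x ≤ y → τ * x < y := by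
    intro x y τ hy h0 h1 hxy
    exact (mul_le_mul_of_nonneg_left hxy h0).trans_lt (mul_lt_of_lt_one_left hy h1)
  have hach : ∀ τ : ℝ, 0 ≤ τ → τ < 1 → BlindAchievable δ₁ δ₂ ε₁ ε₂ (τ • R) := by
    intro τ h0 hτ
    have n1 : 0 ≤ (τ • R).1 := mul_nonneg h0 h1
    have n2 : 0 ≤ (τ • R).2 := mul_nonneg h0 h2
    have s1 := scale hp₁ h0 hτ hR₂
    have s2 := scale hp₂ h0 hτ hR₁
    have linear : R.2 + ε₂ * R.1 ≤ 1 - δ₂ → BlindAchievable δ₁ δ₂ ε₁ ε₂ (τ • R) := by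
      intro hlin
      have s3 := scale hp₂ h0 hτ hlin
      refine blindAchievable_of_lt ⟨hδ₁.1, hδ₁.2.le⟩ ⟨hδ₂.1, hδ₂.2.le⟩ hε₁ hε₂ n1 n2 ?_ ?_
      · simp only [Prod.smul_fst, Prod.smul_snd, smul_eq_mul]; linarith
      · simp only [Prod.smul_fst, Prod.smul_snd, smul_eq_mul]; linarith
    rcases h with ⟨hle, rfl | rfl⟩ | ⟨rfl, rfl⟩
    · exact linear (by linarith)
    · refine blindAchievable_of_timeSharing hδ₁ hδ₂ hε₁ hε₂ n1 n2 ?_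
      simp only [Prod.smul_fst, Prod.smul_snd, smul_eq_mul]
      have e : τ * R.1 / (1 - δ₁) + τ * R.2 / (1 - δ₂)
          = τ * (1 * ((1 - δ₂) / (1 - δ₁)) * R.1 + R.2) / (1 - δ₂) := by field_simp
      rw [e, div_lt_one hp₂]
      exact s2
    · rw [div_self hp₁.ne', mul_one] at hR₁
      exact linear (by linarith)
  have htend : Tendsto (fun j : ℕ => ((j : ℝ) / (j + 1)) • R) atTop (𝓝 R) := by
    have := (tendsto_natCast_div_add_atTop (1 : ℝ)).smul_const R
    simpa using this
  refine mem_closure_of_tendsto htend (Eventually.of_forall fun j => hach _ (by positivity) ?_)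
  rw [div_lt_one (by positivity)]
  linarith

/-! ### The symmetric corner point. -/

theorem tendsto_floor_div {x : ℕ → ℝ} {c : ℝ} (hc : 0 < c)
    (hx : Tendsto (fun n => x n / n) atTop (𝓝 c)) :
    Tendsto (fun n => (⌊x n⌋₊ : ℝ) / n) atTop (𝓝 c) := by
  have hlow : Tendsto (fun n : ℕ => x n / n - 1 / n) atTop (𝓝 c) := by
    simpa using hx.sub (tendsto_const_div_natCast 1)
  refine tendsto_of_tendsto_of_tendsto_of_le_of_le' hlow hx
    (Eventually.of_forall fun n => ?_) ?_
  · rw [← sub_div]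
    exact div_le_div_of_nonneg_right (Nat.sub_one_lt_floor _).le (Nat.cast_nonneg n)
  · filter_upwards [hx.eventually_const_lt hc, eventually_gt_atTop 0] with n hn hn0
    have hn' : (0 : ℝ) < n := by exact_mod_cast hn0
    have : 0 < x n := by
      have := mul_pos hn hn'
      rwa [div_mul_cancel₀ _ hn'.ne'] at this
    exact div_le_div_of_nonneg_right (Nat.floor_le this.le) hn'.le

theorem cornerByRandomCombinations {δ ε : ℝ} (hδ : 0 ≤ δ ∧ δ < 1) (hε : 0 ≤ ε ∧ ε ≤ 1) :
    CornerByRandomCombinations δ ε := by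
  have hp : 0 < 1 - δ := by linarith [hδ.2]
  have hq : 0 < 1 + ε := by linarith [hε.1]
  have hδ' : 0 ≤ δ ∧ δ ≤ 1 := ⟨hδ.1, hδ.2.le⟩
  -- Of the margin 5n^(2/3), four parts are consumed by `tendsto_exp_quadratic` and one pays for the
  -- floor in `k`; being o(n), it leaves the limits unchanged.
  set m : ℕ → ℕ := fun n => ⌊((1 - δ) * n - 5 * cbrt n ^ 2) / (1 + ε)⌋₊ with hm
  set k : ℕ → ℕ := fun n => ⌊(1 - δ) * n⌋₊ with hk
  have hcb : Tendsto (fun n : ℕ => cbrt n ^ 2 / n) atTop (𝓝 0) := by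
    refine (tendsto_inv_atTop_zero.comp tendsto_cbrt).congr' ?_
    filter_upwards [tendsto_cbrt.eventually_gt_atTop 0] with n hn
    rw [← cbrt_pow_three]
    simp only [Function.comp]
    field_simp
  have hm_tend : Tendsto (fun n => (m n : ℝ) / n) atTop (𝓝 ((1 - δ) / (1 + ε))) := by
    refine tendsto_floor_div (by positivity) ?_
    have := ((tendsto_const_nhds (x := 1 - δ)).sub (hcb.const_mul 5)).div_const (1 + ε)
    rw [mul_zero, sub_zero] at this
    refine this.congr' ?_
    filter_upwards [eventually_gt_atTop 0] with n hn
    have hn' : (0 : ℝ) < n := by exact_mod_cast hn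
    field_simp
  have hk_tend : Tendsto (fun n => (k n : ℝ) / n) atTop (𝓝 (1 - δ)) := by
    refine tendsto_floor_div hp ?_
    refine tendsto_const_nhds.congr' ?_
    filter_upwards [eventually_gt_atTop 0] with n hn
    have hn' : (0 : ℝ) < n := by exact_mod_cast hn
    field_simp
  have hkm : Tendsto (fun n => (k n : ℝ) / m n) atTop (𝓝 (1 + ε)) := by
    have := hk_tend.div hm_tend (by positivity)
    rw [div_div_cancel₀ hp.ne'] at this
    refine this.congr' ?_
    filter_upwards [eventually_gt_atTop 0] with n hn
    have hn' : (0 : ℝ) < n := by exact_mod_cast hn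
    simp only [Pi.div_apply]
    rw [div_div_div_cancel_right₀ hn'.ne']
  have hm_le : ∀ᶠ n in atTop, (m n : ℝ) + ε * m n ≤ (1 - δ) * n - 5 * cbrt n ^ 2 := by
    -- For small `n` the numerator can be negative, and the natural floor 0 would then exceed it.
    filter_upwards [eventually_linear_slack (c := (1 - δ) / 2) (C := 0) (by positivity)] with n hn
    have hx : 0 ≤ ((1 - δ) * n - 5 * cbrt n ^ 2) / (1 + ε) :=
      div_nonneg (by nlinarith [sq_nonneg (cbrt n)]) hq.le
    have := Nat.floor_le hx
    rw [le_div_iff₀ hq] at this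
    simp only [hm]
    linarith
  have hεm : ∀ᶠ n : ℕ in atTop, ε * (m n : ℝ) ≤ (1 - δ) * n := by
    filter_upwards [hm_le] with n hn
    have : (0 : ℝ) ≤ m n := Nat.cast_nonneg _
    nlinarith [sq_nonneg (cbrt n)]
  have hd : ∀ n : ℕ, (1 - δ) * (n : ℝ) ≤ n := fun n =>
      mul_le_of_le_one_left (Nat.cast_nonneg _) (by linarith [hδ.1])
  have t1 := tendsto_exp_quadratic (a := fun n => (m n : ℝ) + ε * m n - k n)
    (b := fun n => ε * (m n : ℝ))
    (by
      filter_upwards [hm_le, tendsto_cbrt.eventually_ge_atTop 1] with n hn h1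
      have h2 : (1 - δ) * n - 1 ≤ (k n : ℝ) := (Nat.sub_one_lt_floor _).le
      have h3 : 1 ≤ cbrt n ^ 2 := one_le_pow₀ h1
      linarith)
    (by
      filter_upwards [hεm] with n hn
      have : (0 : ℝ) ≤ n := Nat.cast_nonneg n
      linarith [hd n])
  have t2 := tendsto_exp_quadratic (a := fun n => (m n : ℝ) + ε * m n - (1 - δ) * n)
    (b := fun n => ε * (m n : ℝ) + (1 - δ) * n)
    (by
      filter_upwards [hm_le] with n hn
      linarith [sq_nonneg (cbrt n)])
    (by
      filter_upwards [hεm] with n hn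
      linarith [hd n])
  have hB := tendsto_add_zero (tendsto_add_zero t1 t2) (tendsto_add_zero t1 t2)
  have hex : ∀ n, ∃ G : Matrix (Fin n) (Fin (k n)) (ZMod 2), (cbrt n)⁻¹ ≤ Real.log 2 → _ :=
    fun n => by
      by_cases hn : (cbrt n)⁻¹ ≤ Real.log 2
      · obtain ⟨G, hG⟩ := exists_outer_code (n := n) (k := k n) (m₁ := m n) (m₂ := m n)
          hδ' hδ' hε hε (inv_nonneg.2 (cbrt_nonneg n)) hn
        exact ⟨G, fun _ => hG⟩
      · exact ⟨0, fun h => absurd h hn⟩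
  choose G hG using hex
  have n1 : ∀ n, 0 ≤ uniformMean (fun A : Matrix (Fin (k n)) (Fin (m n) ⊕ Fin (m n)) (ZMod 2) =>
      (combinationCode (G n) A).toNonBlind.err₁ δ δ ε ε) := fun n =>
    (uniformMean_const 0).ge.trans (uniformMean_mono fun A =>
      (combinationCode (G n) A).toNonBlind.err₁_nonneg hδ' hε hε)
  have n2 : ∀ n, 0 ≤ uniformMean (fun A : Matrix (Fin (k n)) (Fin (m n) ⊕ Fin (m n)) (ZMod 2) =>
      (combinationCode (G n) A).toNonBlind.err₂ δ δ ε ε) := fun n =>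
    (uniformMean_const 0).ge.trans (uniformMean_mono fun A =>
      (combinationCode (G n) A).toNonBlind.err₂_nonneg hδ' hε hε)
  refine ⟨m, k, fun n => (G n).mulVec, fun n A => combinationCode (G n) A, hm_tend, hkm,
    fun n A w₁ w₂ => rfl, ?_, ?_⟩
  · refine tendsto_of_tendsto_of_tendsto_of_le_of_le' tendsto_const_nhds hB
      (Eventually.of_forall n1) ?_
    filter_upwards [eventually_inv_cbrt_le] with n hn
    exact (le_add_of_nonneg_right (n2 n)).trans (hG n hn)
  · refine tendsto_of_tendsto_of_tendsto_of_le_of_le' tendsto_const_nhds hB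
      (Eventually.of_forall n2) ?_
    filter_upwards [eventually_inv_cbrt_le] with n hn
    exact (le_add_of_nonneg_left (n1 n)).trans (hG n hn)

end ErasureBC

theorem theorem3 (δ₁ δ₂ ε₁ ε₂ : ℝ)
    (hδ₁ : 0 ≤ δ₁ ∧ δ₁ < 1) (hδ₂ : 0 ≤ δ₂ ∧ δ₂ < 1)
    (hε₁ : 0 ≤ ε₁ ∧ ε₁ ≤ 1) (hε₂ : 0 ≤ ε₂ ∧ ε₂ ≤ 1) :
    (((δ₁ ≤ δ₂ ∧ (ε₂ = 0 ∨ ε₂ = 1)) ∨ (δ₁ = δ₂ ∧ ε₁ = ε₂)) →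
      ErasureBC.blindCapacity δ₁ δ₂ ε₁ ε₂ = ErasureBC.nonBlindCapacity δ₁ δ₂ ε₁ ε₂ ∧
      ErasureBC.blindCapacity δ₁ δ₂ ε₁ ε₂ = ErasureBC.rateRegion δ₁ δ₂ ε₁ ε₂) ∧
    (δ₁ = δ₂ → ε₁ = ε₂ → ErasureBC.CornerByRandomCombinations δ₁ ε₁) := by
  refine ⟨fun h => ?_, fun _ _ => ErasureBC.cornerByRandomCombinations hδ₁ hε₁⟩
  have h1 := ErasureBC.rateRegion_subset_blindCapacity hδ₁ hδ₂ hε₁ hε₂ h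
  have h2 := ErasureBC.blindCapacity_subset_nonBlindCapacity δ₁ δ₂ ε₁ ε₂
  have h3 := ErasureBC.nonBlindCapacity_subset_rateRegion hδ₁ hδ₂ hε₁ hε₂ h
  exact ⟨h2.antisymm (h3.trans h1), (h2.trans h3).antisymm h1⟩
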